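/- Let $M$ be a Coxeter diagram of type $A_n$ ($n\ge 1$), $D_n$ ($n\ge 4$) or $E_n$ ($n=6,7,8$), and write $i\sim j$ if the nodes $i,j$ are adjacent. Let $\Phi^+$ be the set of positive roots of the root system of type $M$, with simple roots $\alpha_i$ and form normalized by $(\alpha_i,\alpha_i)=2$; let $\alpha_0$ be the highest root, $W$ the Weyl group, and $C$ the set of nodes $j$ with $(\alpha_j,\alpha_0)=0$. Let $A$ be the Artin group of type $M$, with generators $s_i$ and relations $s_is_j=s_js_i$ if $i\not\sim j$, $s_is_js_i=s_js_is_j$ if $i\sim j$. Let $l,x$ be indeterminates and $m=(l-l^{-1})/(1-x)\in\mathbb Q(l,x)$. Let $Z_0^{(0)}$ be the Hecke algebra of type $M|_C$ over $\mathbb Q[l^{\pm1},m]$: generators $z_j$ ($j\in C$), the braid relations of $M|_C$, and $z_j^2+mz_j-1=0$. Let $Z_0^{(1)}$ be its subalgebra generated over $\mathbb Q[m]$ by the $z_j$. For $\beta\in\Phi^+$ let $d_\beta\in A$ be the product $s_{i_1}\cdots s_{i_t}$ for a reduced expression $r_{i_1}\cdots r_{i_t}$ of the shortest element of $W$ mapping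 $\alpha_0$ to $\beta$. If $(\alpha_i,\beta)=0$, then $d_\beta^{-1}s_id_\beta=s_j$ for a unique $j\in C$, and we put $h_{\beta,i}=z_j\in Z_0^{(1)}$; thus $h_{\beta,i}^{-1}=h_{\beta,i}+m$. Let $V^{(0)}$ be the free right $Z_0^{(0)}$-module with basis $x_\beta$ ($\beta\in\Phi^+$), and let $\tau_i$ be its $Z_0^{(0)}$-linear endomorphism with $$\tau_i(x_\beta)=\begin{cases}0&(\alpha_i,\beta)=2,\\ x_{\beta-\alpha_i}&(\alpha_i,\beta)=1,\\ x_\beta h_{\beta,i}&(\alpha_i,\beta)=0,\\ x_{\beta+\alpha_i}-m\,x_\beta&(\alpha_i,\beta)=-1.\end{cases}$$ For a family $(T_{i,\beta})$ in $Z_0^{(0)}$, indexed by the nodes $i$ and $\beta\in\Phi^+$, let $T_i$ be the $Z_0^{(0)}$-linear endomorphism of $V^{(0)}$ with $T_i(x_\beta)=x_{\alpha_i}T_{i,\beta}$. **Theorem.** There is a unique family $(T_{i,\beta})$ in $Z_0^{(1)}$ with $T_{i,\alpha_i}=1$ for all $i$ such that $s_i\mapsto\sigma_i=\tau_i+l^{-1}T_i$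 defines a representation of $A$ on $V^{(0)}$ by $Z_0^{(0)}$-linear maps. This family is a solution, and the only solution among all families in $Z_0^{(0)}$, of the following equations (for all nodes $i,j$ and all $\beta\in\Phi^+$): * $T_{i,\beta}=0$ if $\beta=\alpha_j$, $i\neq j$; * $T_{i,\beta}=1$ if $\beta=\alpha_i$; * $T_{i,\beta}=m$ if $\beta=\alpha_i+\alpha_j$; * $T_{i,\beta}=h_{\alpha_i,j}^{-1}T_{i,\beta-\alpha_j}$ if $(\alpha_j,\beta)=1$, $(\alpha_i,\alpha_j)=0$; * $T_{i,\beta}=T_{j,\beta-\alpha_i-\alpha_j}+mT_{i,\beta-\alpha_j}$ if $(\alpha_i,\beta)=0$, $(\alpha_j,\beta)=1$, $(\alpha_i,\alpha_j)=-1$; * $T_{i,\beta}=T_{j,\beta-\alpha_j}h_{\beta-\alpha_j,i}+mT_{i,\beta-\alpha_j}$ if $(\alpha_i,\beta)=-1$, $(\alpha_j,\beta)=1$, $(\alpha_i,\alpha_j)=-1$; * $T_{i,\beta}=T_{j,\beta-\alpha_i}h_{\beta,j}^{-1}$ if $(\alpha_i,\beta)=1$, $(\alpha_j,\beta)=0$,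 $(\alpha_i,\alpha_j)=-1$. Moreover, let $B$ be the BMW algebra of type $M$: the $\mathbb Q(l,x)$-algebra with generators $g_i,e_i$ and relations $g_ig_j=g_jg_i$ ($i\not\sim j$), $g_ig_jg_i=g_jg_ig_j$ ($i\sim j$), $me_i=l(g_i^2+mg_i-1)$, $g_ie_i=l^{-1}e_i$, and $e_ig_je_i=le_i$ ($i\sim j$); and let $I_2$ be the two-sided ideal of $B$ generated by all $e_ie_j$ with $i\ne j$, $i\not\sim j$. Then the $g_i$ are invertible in $B$, $s_i\mapsto g_i$ defines a homomorphism $A\to B^\times$, and the representation of $A$ on $V=\mathbb Q(l,x)\otimes V^{(0)}$ (tensor product over $\mathbb Q[l^{\pm1},m]$) is the composite of $A\to B^\times\to B/I_2$ with a homomorphism of $\mathbb Q(l,x)$-algebras $B/I_2\to\operatorname{End}(V)$. -/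

import Mathlib

namespace GenLK

open TensorProduct MulOpposite

noncomputable section

/-! ### The scalars

`K = ℚ(l, x)`, the element `m = (l - l⁻¹) / (1 - x)` of it, and the subring `ℚ[l, l⁻¹, m]`. -/

/-- The field `ℚ(l, x)` of rational functions in two indeterminates. -/
abbrev K : Type := FractionRing (MvPolynomial (Fin 2) ℚ)

/-- The indeterminate `l`. -/
def l : K := algebraMap (MvPolynomial (Fin 2) ℚ) K (MvPolynomial.X 0)

/-- The indeterminate `x`. -/
def x : K := algebraMap (MvPolynomial (Fin 2) ℚ) K (MvPolynomial.X 1)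

/-- The element `m = (l - l⁻¹) / (1 - x)` of `ℚ(l, x)`. -/
def m : K := (l - l⁻¹) / (1 - x)

/-- The subring `ℚ[l, l⁻¹, m]` of `ℚ(l, x)`. -/
abbrev R₀ : Subalgebra ℚ K := Algebra.adjoin ℚ {l, l⁻¹, m}

/-- `l⁻¹` as an element of `ℚ[l, l⁻¹, m]`. -/
def linv₀ : R₀ := ⟨l⁻¹, Algebra.subset_adjoin (by simp)⟩

/-- `m` as an element of `ℚ[l, l⁻¹, m]`. -/
def m₀ : R₀ := ⟨m, Algebra.subset_adjoin (by simp)⟩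

/-! ### Diagrams and roots

A simply laced Coxeter diagram is a simple graph `M` on its set `I` of nodes. -/

section Roots

variable {I : Type*} [Fintype I] [DecidableEq I] (M : SimpleGraph I)

open Classical in
/-- The Cartan matrix of a simply laced diagram. -/
def cartan : Matrix I I ℤ := Matrix.of fun i j =>
  if i = j then 2 else if M.Adj i j then -1 else 0

/-- The diagram is, up to a relabelling of its nodes, one of
`A_n` (`n ≥ 1`), `D_n` (`n ≥ 4`), `E_6`, `E_7`, `E_8`. -/
def IsADE : Prop :=
  (∃ n, 1 ≤ n ∧ ∃ e : I ≃ Fin n, Matrix.reindex e e (cartan M) = CartanMatrix.A n) ∨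
  (∃ n, 4 ≤ n ∧ ∃ e : I ≃ Fin n, Matrix.reindex e e (cartan M) = CartanMatrix.D n) ∨
  (∃ e : I ≃ Fin 6, Matrix.reindex e e (cartan M) = CartanMatrix.E₆) ∨
  (∃ e : I ≃ Fin 7, Matrix.reindex e e (cartan M) = CartanMatrix.E₇) ∨
  (∃ e : I ≃ Fin 8, Matrix.reindex e e (cartan M) = CartanMatrix.E₈)

/-- The invariant symmetric bilinear form, in coordinates with respect to the simple roots. -/
def form (u v : I → ℤ) : ℤ := ∑ i, ∑ j, u i * cartan M i j * v j

/-- The simple root `α_i`. -/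
def simple (i : I) : I → ℤ := Pi.single i 1

/-- The simple reflection `r_i`. -/
def refl (i : I) (v : I → ℤ) : I → ℤ := v - form M (simple i) v • simple i

/-- The roots: the orbit of the simple roots under the group generated by the simple
reflections. -/
inductive IsRoot : (I → ℤ) → Prop
  | simple (i : I) : IsRoot (simple i)
  | refl (i : I) {v : I → ℤ} : IsRoot v → IsRoot (refl M i v)

/-- The positive roots: those with nonnegative coordinates. -/
def IsPosRoot (v : I → ℤ) : Prop := IsRoot M v ∧ 0 ≤ v

/-- The set `Φ⁺` of positive roots. -/
abbrev PosRoot : Type _ := {v : I → ℤ // IsPosRoot M v}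

/-- The simple root `α_i` as an element of `Φ⁺`. -/
def simpleRoot (i : I) : PosRoot M :=
  ⟨simple i, IsRoot.simple i, Pi.single_nonneg.2 zero_le_one⟩

open Classical in
/-- The highest root `α₀`, that is, the positive root which is coordinatewise at least as
large as every positive root. -/
def highestRoot : I → ℤ :=
  if h : ∃ θ, IsPosRoot M θ ∧ ∀ γ, IsPosRoot M γ → γ ≤ θ then h.choose else 0

/-- The set `C` of nodes whose simple root is orthogonal to the highest root. -/
def C : Set I := {j | form M (simple j) (highestRoot M) = 0}

/-- The action of the word `i₁ i₂ ⋯ i_t`, that is, of `r_{i₁} r_{i₂} ⋯ r_{i_t}`. -/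
def wordAct (ω : List I) (v : I → ℤ) : I → ℤ := ω.foldr (refl M) v

/-- `ω` is a word of minimal length among those that map `α₀` to `β`. Since the word length of
an element of the Weyl group `W` is the minimal length of a word representing it, such an `ω` is
a reduced expression of a shortest element of `W` that maps `α₀` to `β`. -/
def IsShortestWord (ω : List I) (β : I → ℤ) : Prop :=
  wordAct M ω (highestRoot M) = β ∧
    ∀ ω' : List I, wordAct M ω' (highestRoot M) = β → ω.length ≤ ω'.length

end Roots

/-! ### The Artin group -/

section Artin

variable {I : Type*} (M : SimpleGraph I)

/-- The braid relations. -/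
inductive ArtinRel : FreeGroup I → Prop
  | comm (i j : I) : ¬ M.Adj i j → ArtinRel
      (FreeGroup.of i * FreeGroup.of j * (FreeGroup.of j * FreeGroup.of i)⁻¹)
  | braid (i j : I) : M.Adj i j → ArtinRel
      (FreeGroup.of i * FreeGroup.of j * FreeGroup.of i *
        (FreeGroup.of j * FreeGroup.of i * FreeGroup.of j)⁻¹)

/-- The Artin group of type `M`. -/
abbrev Artin : Type _ := PresentedGroup ({w | ArtinRel M w})

/-- The standard generator `s_i` of the Artin group. -/
def s (i : I) : Artin M := PresentedGroup.of i

variable [Fintype I] [DecidableEq I]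

open Classical in
/-- The element `d_β` of the Artin group: the lift, through a reduced expression, of the shortest
element of the Weyl group that maps `α₀` to `β` (the inverse of the shortest element that maps
`β` to `α₀`). -/
def d (β : PosRoot M) : Artin M :=
  if h : ∃ ω, IsShortestWord M ω β.1 then (h.choose.map (s M)).prod else 1

/-- The element `h_{β,i} = d_β⁻¹ s_i d_β` of the Artin group. -/
def hArtin (β : PosRoot M) (i : I) : Artin M := (d M β)⁻¹ * s M i * d M β

end Artin

/-! ### Hecke algebras -/

/-- The relations of the Hecke algebra with parameter `q`: the braid relations, and
`z_i² + q z_i - 1 = 0`. -/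
inductive HeckeRel {J R : Type*} [CommRing R] (G : SimpleGraph J) (q : R) :
    FreeAlgebra R J → FreeAlgebra R J → Prop
  | comm (i j : J) : ¬ G.Adj i j → HeckeRel G q
      (FreeAlgebra.ι R i * FreeAlgebra.ι R j) (FreeAlgebra.ι R j * FreeAlgebra.ι R i)
  | braid (i j : J) : G.Adj i j → HeckeRel G q
      (FreeAlgebra.ι R i * FreeAlgebra.ι R j * FreeAlgebra.ι R i)
      (FreeAlgebra.ι R j * FreeAlgebra.ι R i * FreeAlgebra.ι R j)
  | quad (i : J) : HeckeRel G q
      (FreeAlgebra.ι R i * FreeAlgebra.ι R i + q • FreeAlgebra.ι R i - 1) 0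

/-- The Hecke algebra of type `G` over `R` with parameter `q`. -/
abbrev Hecke {J R : Type*} [CommRing R] (G : SimpleGraph J) (q : R) : Type _ :=
  RingQuot (HeckeRel G q)

section Rep

variable {I : Type*} [Fintype I] [DecidableEq I] (M : SimpleGraph I)

/-- The Hecke algebra `Z₀⁽⁰⁾` of type `M|_C` over `ℚ[l, l⁻¹, m]`. -/
def Z₀ : Type _ := Hecke (M.induce (C M)) m₀

instance : Ring (Z₀ M) := inferInstanceAs (Ring (Hecke (M.induce (C M)) m₀))

instance : Algebra R₀ (Z₀ M) := inferInstanceAs (Algebra R₀ (Hecke (M.induce (C M)) m₀))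

instance : Algebra ℚ (Z₀ M) := Algebra.compHom (Z₀ M) (algebraMap ℚ R₀)

instance : IsScalarTower ℚ R₀ (Z₀ M) := IsScalarTower.of_algebraMap_eq fun _ => rfl

/-- The generator `z_j` (`j ∈ C`) of the Hecke algebra. -/
def z (j : C M) : Z₀ M := RingQuot.mkAlgHom R₀ (HeckeRel (M.induce (C M)) m₀) (FreeAlgebra.ι R₀ j)

/-- The subalgebra `Z₀⁽¹⁾` of `Z₀⁽⁰⁾` generated over `ℚ[m]` by the `z_j`. -/
def Z₁ : Subalgebra ℚ (Z₀ M) :=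
  Algebra.adjoin ℚ (insert (algebraMap R₀ (Z₀ M) m₀) (Set.range (z M)))

open Classical in
/-- The image in the Hecke algebra of the element `h_{β,i}` of the Artin group, where
`(α_i, β) = 0`: the element `h_{β,i}` is equal to `s_j` for a node `j ∈ C`, and its image is
`z_j`. -/
def h (β : PosRoot M) (i : I) : Z₀ M :=
  if H : ∃ j : C M, hArtin M β i = s M j then z M H.choose else 0

/-- The image `h_{β,i} + m` in the Hecke algebra of `h_{β,i}⁻¹`
(as `z_j⁻¹ = z_j + m` by the quadratic relation). -/
def hInv (β : PosRoot M) (i : I) : Z₀ M := h M β i + algebraMap R₀ (Z₀ M) m₀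

/-- The free right `Z₀⁽⁰⁾`-module `V⁽⁰⁾` with basis `x_β`, `β ∈ Φ⁺`. A right module over a ring
is a module over the opposite ring. -/
abbrev V₀ : Type _ := PosRoot M →₀ Z₀ M

/-- The basis vector `x_v`, for a positive root `v`. -/
def xv (β : PosRoot M) : V₀ M := Finsupp.single β 1

open Classical in
/-- The basis vector `x_v` for a vector `v` that is a positive root (and `0` otherwise). -/
def xv' (v : I → ℤ) : V₀ M := if hv : IsPosRoot M v then xv M ⟨v, hv⟩ else 0

/-- The endomorphism of the right module `V⁽⁰⁾` that maps `x_β` to `f β`. -/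
def ofBasis (f : PosRoot M → V₀ M) : Module.End (Z₀ M)ᵐᵒᵖ (V₀ M) where
  toFun v := v.sum fun β a => op a • f β
  map_add' u v := Finsupp.sum_add_index' (by simp) (by simp [add_smul])
  map_smul' c v := by
    rw [Finsupp.sum_smul_index' (by simp), RingHom.id_apply, Finsupp.smul_sum]
    refine Finsupp.sum_congr fun β _ => ?_
    rw [smul_smul]
    congr 1

theorem ofBasis_xv (f : PosRoot M → V₀ M) (β : PosRoot M) : ofBasis M f (xv M β) = f β := by
  simp [ofBasis, xv]

/-- The endomorphism `τ_i` of `V⁽⁰⁾`. -/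
def tau (i : I) : Module.End (Z₀ M)ᵐᵒᵖ (V₀ M) := ofBasis M fun β =>
  if form M (simple i) β.1 = 2 then 0
  else if form M (simple i) β.1 = 1 then xv' M (β.1 - simple i)
  else if form M (simple i) β.1 = 0 then op (h M β i) • xv M β
  else if form M (simple i) β.1 = -1 then xv' M (β.1 + simple i) - m₀ • xv M β
  else 0

/-- The endomorphism `T_i` of `V⁽⁰⁾` that maps `x_β` to `x_{α_i} T_{i,β}`. -/
def TEnd (T : I → PosRoot M → Z₀ M) (i : I) : Module.End (Z₀ M)ᵐᵒᵖ (V₀ M) :=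
  ofBasis M fun β => op (T i β) • xv M (simpleRoot M i)

/-- `ρ` is a representation of the Artin group on `V⁽⁰⁾` with `s_i ↦ τ_i + l⁻¹ T_i`. -/
def IsRepFor (T : I → PosRoot M → Z₀ M) (ρ : Artin M →* Module.End (Z₀ M)ᵐᵒᵖ (V₀ M)) : Prop :=
  ∀ i, ρ (s M i) = tau M i + linv₀ • TEnd M T i

/-- The `T`-equations. -/
structure TEquations (T : I → PosRoot M → Z₀ M) : Prop where
  off_diag : ∀ i j, i ≠ j → T i (simpleRoot M j) = 0
  diag : ∀ i, T i (simpleRoot M i) = 1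
  height_two : ∀ i j (β : PosRoot M), β.1 = simple i + simple j →
    T i β = algebraMap R₀ (Z₀ M) m₀
  comm : ∀ i j (β β' : PosRoot M),
    form M (simple j) β.1 = 1 → form M (simple i) (simple j) = 0 → β'.1 = β.1 - simple j →
    T i β = hInv M (simpleRoot M i) j * T i β'
  zero_one : ∀ i j (β β' β'' : PosRoot M),
    form M (simple i) β.1 = 0 → form M (simple j) β.1 = 1 → form M (simple i) (simple j) = -1 →
    β'.1 = β.1 - simple j → β''.1 = β.1 - simple i - simple j →
    T i β = T j β'' + algebraMap R₀ (Z₀ M) m₀ * T i β'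
  neg_one : ∀ i j (β β' : PosRoot M),
    form M (simple i) β.1 = -1 → form M (simple j) β.1 = 1 → form M (simple i) (simple j) = -1 →
    β'.1 = β.1 - simple j →
    T i β = T j β' * h M β' i + algebraMap R₀ (Z₀ M) m₀ * T i β'
  one_zero : ∀ i j (β β' : PosRoot M),
    form M (simple i) β.1 = 1 → form M (simple j) β.1 = 0 → form M (simple i) (simple j) = -1 →
    β'.1 = β.1 - simple i →
    T i β = T j β' * hInv M β j

/-- The `ℚ(l, x)`-vector space `V = ℚ(l, x) ⊗ V⁽⁰⁾`. -/
abbrev V : Type _ := K ⊗[R₀] V₀ M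

/-- The extension of scalars of an endomorphism of `V⁽⁰⁾` to `V`. -/
def extend (f : Module.End (Z₀ M)ᵐᵒᵖ (V₀ M)) : Module.End K (V M) :=
  LinearMap.baseChange K (f.restrictScalars R₀)

end Rep

/-! ### The BMW algebra -/

section BMW

variable {I : Type*} (M : SimpleGraph I)

/-- The generator `g_i` in the free algebra on all `g_i` and `e_i`. -/
abbrev fg (i : I) : FreeAlgebra K (I ⊕ I) := FreeAlgebra.ι K (Sum.inl i)

/-- The generator `e_i` in the free algebra on all `g_i` and `e_i`. -/
abbrev fe (i : I) : FreeAlgebra K (I ⊕ I) := FreeAlgebra.ι K (Sum.inr i)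

/-- The defining relations of the BMW algebra of type `M`. -/
inductive BMWRel : FreeAlgebra K (I ⊕ I) → FreeAlgebra K (I ⊕ I) → Prop
  | B1 (i j : I) : ¬ M.Adj i j → BMWRel (fg i * fg j) (fg j * fg i)
  | B2 (i j : I) : M.Adj i j → BMWRel (fg i * fg j * fg i) (fg j * fg i * fg j)
  | D1 (i : I) : BMWRel (m • fe i) (l • (fg i * fg i + m • fg i - 1))
  | R1 (i : I) : BMWRel (fg i * fe i) (l⁻¹ • fe i)
  | R2 (i j : I) : M.Adj i j → BMWRel (fe i * fg j * fe i) (l • fe i)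

/-- The BMW algebra `B` of type `M` over `ℚ(l, x)`. -/
abbrev BMW : Type _ := RingQuot (BMWRel M)

/-- The element `g_i` of `B`. -/
def g (i : I) : BMW M := RingQuot.mkAlgHom K (BMWRel M) (fg i)

/-- The element `e_i` of `B`. -/
def e (i : I) : BMW M := RingQuot.mkAlgHom K (BMWRel M) (fe i)

/-- The two-sided ideal `I₂` of `B` generated by all products `e_i e_j` for distinct nonadjacent
nodes `i`, `j`. -/
def I₂ : TwoSidedIdeal (BMW M) :=
  TwoSidedIdeal.span {b | ∃ i j, i ≠ j ∧ ¬ M.Adj i j ∧ b = e M i * e M j}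

/-- The quotient algebra `B / I₂`. -/
abbrev BMWModI₂ : Type _ := (I₂ M).ringCon.Quotient

end BMW

end

end GenLK

namespace GenLK

open TensorProduct MulOpposite

noncomputable section

set_option linter.unusedSectionVars false

/-! ### Simply laced root systems -/

section RootSystem

variable {I : Type*} [Fintype I] [DecidableEq I] (M : SimpleGraph I)

/-! Write T_{i,β} = φ_i(x_β) with right linear functionals φ_i on V⁽⁰⁾. Then σ_i v = τ_i v + l⁻¹
x_{α_i} φ_i(v) perturbs τ_i by a map of rank one. The τ_i alone already satisfy the braid relations
(`tau_comm`, `tau_braid`). Expanding the products of the σ_i shows that they do so too once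
φ_i(x_{α_j}) = δ_{ij}, φ_i τ_j = h_{α_i,j} φ_i for distinct nonadjacent i, j, and φ_i τ_j = φ_j τ_i
for adjacent i, j (`IsCompatible`). Evaluated at basis vectors, these conditions give the
T-equations (`IsCompatible.tEquations`), and the T-equations are a recursion on the height of β with
at most one solution (`TEquations.unique`).

Existence: φ_i is the member φ_{α_i} of a family φ_β indexed by all positive roots. It starts with
the coordinate function of the highest root and descends by φ_β = φ_{β+α_i} ∘ (τ_i + m) when (α_i,
β) = -1. Two different descents to the same root belong to nonadjacent nodes, so φ_β does not depend
on the path; the same argument makes d_β well defined. Away from x_{α_i} one has τ_i² + mτ_i = 1, so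
τ_i + m behaves like an inverse of τ_i. This yields φ_β τ_i = φ_{β+α_i} (`phi_tau_add`) and φ_β τ_j
= h_{β,j} φ_β for α_j orthogonal to β (`phi_tau_zero`). For adjacent nodes φ_{α_i} τ_j and φ_{α_j}
τ_i are therefore both equal to φ_{α_i+α_j}.

Uniqueness of the representation: a coordinate of a braid relation between the σ_i is a polynomial
identity in l⁻¹ with coefficients in Z₀⁽¹⁾. An endomorphism of Z₀⁽⁰⁾ that fixes Z₀⁽¹⁾ and doubles
l⁻¹ separates the powers of l⁻¹ (`eq_zero_of_linv₀_smul`), and the separate coefficients say that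
the φ_i are compatible (`isCompatible_of_sigma`).

BMW algebra: σ_i² + mσ_i - 1 maps V⁽⁰⁾ into x_{α_i} Z₀⁽⁰⁾, on which σ_i acts as l⁻¹. After division
by m l⁻¹ it serves as the image of e_i, and the products for distinct nonadjacent nodes vanish.

The root system enters only through positive definiteness and connectedness of the diagram; positive
roots are the nonnegative integral vectors of norm 2 (`isPosRoot_iff`). -/

theorem cartan_self (i : I) : cartan M i i = 2 := by simp [cartan]

theorem cartan_of_adj {i j : I} (h : M.Adj i j) : cartan M i j = -1 := by
  simp [cartan, h, h.ne]

theorem cartan_of_not_adj {i j : I} (hij : i ≠ j) (h : ¬ M.Adj i j) : cartan M i j = 0 := by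
  simp [cartan, h, hij]

theorem cartan_comm (i j : I) : cartan M i j = cartan M j i := by
  by_cases h : M.Adj i j
  · rw [cartan_of_adj M h, cartan_of_adj M h.symm]
  · have h' : ¬ M.Adj j i := fun hn => h hn.symm
    simp only [cartan, Matrix.of_apply, h, h', eq_comm (a := i)]

theorem cartan_nonpos {i j : I} (hij : i ≠ j) : cartan M i j ≤ 0 := by
  simp only [cartan, Matrix.of_apply, hij, if_false]
  split_ifs <;> simp

theorem form_eq_dotProduct (u v : I → ℤ) :
    form M u v = dotProduct u ((cartan M).mulVec v) := by
  simp [form, dotProduct, Matrix.mulVec, Finset.mul_sum, mul_assoc]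

theorem form_add_left (u u' v : I → ℤ) : form M (u + u') v = form M u v + form M u' v := by
  simp [form_eq_dotProduct]

theorem form_sub_left (u u' v : I → ℤ) : form M (u - u') v = form M u v - form M u' v := by
  simp [form_eq_dotProduct]

theorem form_neg_left (u v : I → ℤ) : form M (-u) v = -form M u v := by
  simp [form_eq_dotProduct]

theorem form_smul_left (c : ℤ) (u v : I → ℤ) : form M (c • u) v = c * form M u v := by
  rw [form_eq_dotProduct, smul_dotProduct, smul_eq_mul, form_eq_dotProduct]

theorem form_comm (u v : I → ℤ) : form M u v = form M v u := by
  rw [form, Finset.sum_comm, form]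
  refine Finset.sum_congr rfl fun i _ => Finset.sum_congr rfl fun j _ => ?_
  rw [cartan_comm M j i]; ring

theorem form_add_right (u v v' : I → ℤ) : form M u (v + v') = form M u v + form M u v' := by
  simp [form_eq_dotProduct, Matrix.mulVec_add]

theorem form_sub_right (u v v' : I → ℤ) : form M u (v - v') = form M u v - form M u v' := by
  simp [form_eq_dotProduct, Matrix.mulVec_sub]

theorem form_neg_right (u v : I → ℤ) : form M u (-v) = -form M u v := by
  simp [form_eq_dotProduct, Matrix.mulVec_neg]

theorem form_smul_right (c : ℤ) (u v : I → ℤ) : form M u (c • v) = c * form M u v := by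
  rw [form_comm, form_smul_left, form_comm]

theorem form_simple_left (i : I) (v : I → ℤ) :
    form M (simple i) v = ∑ j, cartan M i j * v j := by
  rw [form_eq_dotProduct, simple, single_one_dotProduct]
  rfl

theorem form_simple_simple (i j : I) : form M (simple i) (simple j) = cartan M i j := by
  rw [form_simple_left]
  simp [simple, Pi.single_apply]

theorem form_eq_sum (u v : I → ℤ) : form M u v = ∑ i, u i * form M (simple i) v := by
  simp only [form_simple_left, Finset.mul_sum]
  simp only [form, mul_assoc]

theorem form_adj {i j : I} (h : M.Adj i j) : form M (simple i) (simple j) = -1 := by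
  rw [form_simple_simple, cartan_of_adj M h]

theorem form_not_adj {i j : I} (hij : i ≠ j) (h : ¬ M.Adj i j) :
    form M (simple i) (simple j) = 0 := by
  rw [form_simple_simple, cartan_of_not_adj M hij h]

theorem form_self (i : I) : form M (simple i) (simple i) = 2 := by
  rw [form_simple_simple, cartan_self]

theorem adj_of_form {i j : I} (h : form M (simple i) (simple j) = -1) : M.Adj i j := by
  rw [form_simple_simple] at h
  by_contra hn
  by_cases hij : i = j
  · subst hij; rw [cartan_self] at h; omega
  · rw [cartan_of_not_adj M hij hn] at h; omega

theorem ne_of_form {i j : I} (h : form M (simple i) (simple j) = 0) : i ≠ j := by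
  rintro rfl; rw [form_self] at h; omega

theorem not_adj_of_form {i j : I} (h : form M (simple i) (simple j) = 0) : ¬ M.Adj i j := by
  intro hn; rw [form_adj M hn] at h; omega

theorem form_refl_refl (i : I) (u v : I → ℤ) :
    form M (refl M i u) (refl M i v) = form M u v := by
  simp only [refl, form_sub_left, form_sub_right, form_smul_left, form_smul_right, form_self,
    form_comm M u (simple i)]
  ring

theorem refl_refl (i : I) (v : I → ℤ) : refl M i (refl M i v) = v := by
  simp only [refl, form_sub_right, form_smul_right, form_self]
  ext j
  simp only [Pi.sub_apply, Pi.smul_apply, smul_eq_mul]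
  ring

/-- Modulo 2 the terms for (i, j) and (j, i) cancel by symmetry, and the diagonal terms have the
even factor 2. -/
theorem even_form (v : I → ℤ) : Even (form M v v) := by
  rw [← (ZMod.intCast_zmod_eq_zero_iff_dvd _ 2).trans even_iff_two_dvd.symm, form]
  push_cast
  rw [← Finset.sum_product']
  refine Finset.sum_involution (fun p _ => (p.2, p.1)) ?_ ?_ ?_ ?_
  · rintro ⟨i, j⟩ -
    rw [cartan_comm M j i]
    have : (2 : ZMod 2) = 0 := rfl
    linear_combination (v i * cartan M i j * v j : ZMod 2) * this
  · rintro ⟨i, j⟩ - h he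
    obtain rfl : j = i := congrArg Prod.fst he
    have : (2 : ZMod 2) = 0 := rfl
    simp [cartan_self, this] at h
  · simp
  · simp

/-- The diagram is connected, and its Cartan matrix is positive definite, as is certified by a
positive vector whose image under the matrix is positive. -/
class FiniteType : Prop where
  exists_pos : ∃ u : I → ℤ, (∀ i, 0 < u i) ∧ ∀ i, 0 < form M (simple i) u
  connected : ∀ S : Set I, S.Nonempty → (∀ i j, i ∈ S → M.Adj i j → j ∈ S) → S = Set.univ
  nonempty : Nonempty I

/-- Put w = v/u. Off the diagonal the Cartan entries are nonpositive, so replacing w_i w_j by (w_i²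
+ w_j²)/2 can only decrease the form, and what remains is the diagonal sum of w_i² u_i (α_i, u).
Every term of it is nonnegative, so a single one bounds the form from below. This gives both
positive definiteness and a bound on the coordinates of roots. -/
theorem mul_sq_le_mul_form {u : I → ℤ} (hu : ∀ i, 0 < u i)
    (hc : ∀ i, 0 < form M (simple i) u) (v : I → ℤ) (i : I) :
    form M (simple i) u * v i ^ 2 ≤ u i * form M v v := by
  have hu' : ∀ i, (0 : ℚ) < u i := fun i => by exact_mod_cast hu i
  set w : I → ℚ := fun i => v i / u i with hw
  have hv : ∀ i, (v i : ℚ) = w i * u i := fun i => by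
    rw [hw]; field_simp [(hu' i).ne']
  have h1 : ∀ i j, (cartan M i j : ℚ) * u i * u j * (w i ^ 2 + w j ^ 2) / 2 ≤
      v i * cartan M i j * v j := by
    intro i j
    rw [hv i, hv j]
    by_cases hij : i = j
    · subst hij; apply le_of_eq; ring
    · have h0 : (cartan M i j : ℚ) ≤ 0 := by exact_mod_cast cartan_nonpos M hij
      have : 0 ≤ -(cartan M i j : ℚ) * (u i * u j) * (w i - w j) ^ 2 :=
        mul_nonneg (mul_nonneg (by linarith) (mul_pos (hu' i) (hu' j)).le) (sq_nonneg _)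
      nlinarith
  have h2 : ∑ i, ∑ j, (cartan M i j : ℚ) * u i * u j * (w i ^ 2 + w j ^ 2) / 2 =
      ∑ i, w i ^ 2 * u i * (form M (simple i) u : ℚ) := by
    have e1 : ∑ i, ∑ j, (cartan M i j : ℚ) * u i * u j * w j ^ 2 =
        ∑ i, ∑ j, (cartan M i j : ℚ) * u i * u j * w i ^ 2 := by
      rw [Finset.sum_comm]
      refine Finset.sum_congr rfl fun i _ => Finset.sum_congr rfl fun j _ => ?_
      rw [cartan_comm M j i]; ring
    have e2 : ∑ i, ∑ j, (cartan M i j : ℚ) * u i * u j * w i ^ 2 =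
        ∑ i, w i ^ 2 * u i * (form M (simple i) u : ℚ) := by
      refine Finset.sum_congr rfl fun i _ => ?_
      rw [form_simple_left]
      push_cast
      rw [Finset.mul_sum]
      exact Finset.sum_congr rfl fun j _ => by ring
    rw [← e2]
    have : ∀ i j, (cartan M i j : ℚ) * u i * u j * (w i ^ 2 + w j ^ 2) / 2 =
        (cartan M i j : ℚ) * u i * u j * w i ^ 2 / 2 +
          (cartan M i j : ℚ) * u i * u j * w j ^ 2 / 2 := fun i j => by ring
    simp only [this, Finset.sum_add_distrib, ← Finset.sum_div, e1]
    ring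
  have h3 : ∑ i, w i ^ 2 * u i * (form M (simple i) u : ℚ) ≤ (form M v v : ℚ) := by
    rw [← h2, form]
    push_cast
    exact Finset.sum_le_sum fun i _ => Finset.sum_le_sum fun j _ => h1 i j
  have h4 : w i ^ 2 * u i * (form M (simple i) u : ℚ) ≤ (form M v v : ℚ) := by
    refine le_trans ?_ h3
    refine Finset.single_le_sum (f := fun i => w i ^ 2 * u i * (form M (simple i) u : ℚ))
      (fun j _ => ?_) (Finset.mem_univ i)
    have : (0 : ℚ) < form M (simple j) u := by exact_mod_cast hc j
    have := hu' j
    positivity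
  have h5 : ((form M (simple i) u * v i ^ 2 : ℤ) : ℚ) ≤ (u i * form M v v : ℤ) := by
    push_cast
    rw [hv i]
    have := mul_le_mul_of_nonneg_left h4 (hu' i).le
    nlinarith
  exact_mod_cast h5

variable [FiniteType M]

theorem form_nonneg (v : I → ℤ) : 0 ≤ form M v v := by
  obtain ⟨u, hu, hc⟩ := FiniteType.exists_pos (M := M)
  obtain ⟨i⟩ := FiniteType.nonempty (M := M)
  have := mul_sq_le_mul_form M hu hc v i
  have h0 : 0 ≤ u i * form M v v := le_trans (mul_nonneg (hc i).le (sq_nonneg _)) this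
  exact nonneg_of_mul_nonneg_right h0 (hu i)

theorem eq_zero_of_form {v : I → ℤ} (h : form M v v = 0) : v = 0 := by
  obtain ⟨u, hu, hc⟩ := FiniteType.exists_pos (M := M)
  ext i
  have := mul_sq_le_mul_form M hu hc v i
  rw [h, mul_zero] at this
  have h2 : v i ^ 2 ≤ 0 := nonpos_of_mul_nonpos_right this (hc i)
  exact pow_eq_zero_iff two_ne_zero |>.1 (le_antisymm h2 (sq_nonneg _))

theorem two_le_form {v : I → ℤ} (h : v ≠ 0) : 2 ≤ form M v v := by
  have h0 := form_nonneg M v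
  have h1 : form M v v ≠ 0 := fun h' => h (eq_zero_of_form M h')
  obtain ⟨k, hk⟩ := even_form M v
  omega

theorem eq_of_form_eq_two {u v : I → ℤ} (hu : form M u u = 2) (hv : form M v v = 2)
    (h : 2 ≤ form M u v) : u = v := by
  refine sub_eq_zero.1 (eq_zero_of_form M (le_antisymm ?_ (form_nonneg M _)))
  simp only [form_sub_left, form_sub_right, form_comm M v u, hu, hv]
  omega

theorem eq_neg_of_form_eq_neg_two {u v : I → ℤ} (hu : form M u u = 2) (hv : form M v v = 2)
    (h : form M u v ≤ -2) : u = -v := by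
  refine eq_of_form_eq_two M hu ?_ ?_
  · simp [form_neg_left, form_neg_right, hv]
  · rw [form_neg_right]; omega

/-- The vectors of norm two are positive or negative. -/
theorem nonneg_or_nonpos {v : I → ℤ} (h : form M v v = 2) : 0 ≤ v ∨ v ≤ 0 := by
  set p : I → ℤ := fun i => max (v i) 0
  set q : I → ℤ := fun i => max (-v i) 0
  have hpq : v = p - q := by
    ext i; simp only [p, q, Pi.sub_apply]; omega
  -- The positive and negative parts have disjoint supports, so only off-diagonal Cartan entries
  -- contribute. If both parts were nonzero, the norm of `v` would be at least 4.
  have h1 : form M p q ≤ 0 := by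
    rw [form]
    refine Finset.sum_nonpos fun i _ => Finset.sum_nonpos fun j _ => ?_
    by_cases hij : i = j
    · subst hij
      rcases le_total (v i) 0 with hi | hi
      · have : p i = 0 := by simp [p, hi]
        simp [this]
      · have : q i = 0 := by simp [q, hi]
        simp [this]
    · exact mul_nonpos_of_nonpos_of_nonneg
        (mul_nonpos_of_nonneg_of_nonpos (le_max_right _ _) (cartan_nonpos M hij))
        (le_max_right _ _)
  have h2 : form M p p + form M q q - 2 * form M p q = 2 := by
    have := congrArg (fun w => form M w w) hpq
    simp only [form_sub_left, form_sub_right, form_comm M q p, h] at this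
    linarith
  by_cases hp : p = 0
  · right
    intro i
    have := congrFun hp i
    simp only [p, Pi.zero_apply] at this ⊢
    omega
  by_cases hq : q = 0
  · left
    intro i
    have := congrFun hq i
    simp only [q, Pi.zero_apply] at this ⊢
    omega
  have := two_le_form M hp
  have := two_le_form M hq
  omega

theorem form_self_of_isRoot {v : I → ℤ} (h : IsRoot M v) : form M v v = 2 := by
  induction h with
  | simple i => exact form_self M i
  | refl i _ ih => rw [form_refl_refl, ih]

/-- The height of a vector. -/
def ht : (I → ℤ) →+ ℤ where
  toFun v := ∑ i, v i
  map_zero' := by simp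
  map_add' := by simp [Finset.sum_add_distrib]

@[simp] theorem ht_simple (i : I) : ht (simple i) = 1 := by simp [ht, simple]

theorem ht_nonneg {v : I → ℤ} (h : 0 ≤ v) : 0 ≤ ht v :=
  Finset.sum_nonneg fun i _ => h i

theorem ht_pos {v : I → ℤ} (h : 0 ≤ v) (h0 : v ≠ 0) : 0 < ht v := by
  obtain ⟨i, hi⟩ := Function.ne_iff.1 h0
  have : 0 < v i := lt_of_le_of_ne (h i) (Ne.symm hi)
  exact Finset.sum_pos' (fun j _ => h j) ⟨i, Finset.mem_univ i, this⟩

theorem ht_le {v w : I → ℤ} (h : v ≤ w) : ht v ≤ ht w :=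
  Finset.sum_le_sum fun i _ => h i

theorem exists_form_pos {v : I → ℤ} (h : form M v v = 2) (h0 : 0 ≤ v) :
    ∃ i, 0 < v i ∧ 0 < form M (simple i) v := by
  by_contra! hn
  have : form M v v ≤ 0 := by
    rw [form_eq_sum]
    refine Finset.sum_nonpos fun i _ => ?_
    rcases (h0 i).lt_or_eq with hi | hi
    · exact mul_nonpos_of_nonneg_of_nonpos (h0 i) (hn i hi)
    · rw [← hi]; simp
  omega

theorem form_simple_le_two (i : I) {v : I → ℤ} (h : form M v v = 2) :
    form M (simple i) v ≤ 2 := by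
  have := form_nonneg M (v - simple i)
  simp only [form_sub_left, form_sub_right, form_self, h, form_comm M v (simple i)] at this
  omega

theorem neg_two_le_form_simple (i : I) {v : I → ℤ} (h : form M v v = 2) :
    -2 ≤ form M (simple i) v := by
  have := form_nonneg M (v + simple i)
  simp only [form_add_left, form_add_right, form_self, h, form_comm M v (simple i)] at this
  omega

theorem form_add_simple {i : I} {v : I → ℤ} (h : form M v v = 2)
    (hi : form M (simple i) v = -1) : form M (v + simple i) (v + simple i) = 2 := by
  simp only [form_add_left, form_add_right, form_self, h, form_comm M v (simple i), hi]
  norm_num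

theorem form_sub_simple {i : I} {v : I → ℤ} (h : form M v v = 2)
    (hi : form M (simple i) v = 1) : form M (v - simple i) (v - simple i) = 2 := by
  simp only [form_sub_left, form_sub_right, form_self, h, form_comm M v (simple i), hi]
  norm_num

theorem coord_pos_of_form_pos {i : I} {v : I → ℤ} (h0 : 0 ≤ v)
    (hi : 0 < form M (simple i) v) : 0 < v i := by
  by_contra hn
  have hv : v i = 0 := le_antisymm (not_lt.1 hn) (h0 i)
  have : form M (simple i) v ≤ 0 := by
    rw [form_simple_left]
    refine Finset.sum_nonpos fun j _ => ?_
    by_cases hij : i = j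
    · rw [← hij, hv, mul_zero]
    · exact mul_nonpos_of_nonpos_of_nonneg (cartan_nonpos M hij) (h0 j)
  omega

theorem sub_simple_nonneg {i : I} {v : I → ℤ} (h0 : 0 ≤ v)
    (hi : 0 < form M (simple i) v) : 0 ≤ v - simple i := by
  have := coord_pos_of_form_pos M h0 hi
  intro j
  by_cases hij : j = i
  · subst hij; simp [simple]; omega
  · simpa [simple, hij] using h0 j

theorem add_simple_nonneg (i : I) {v : I → ℤ} (h0 : 0 ≤ v) : 0 ≤ v + simple i :=
  add_nonneg h0 (Pi.single_nonneg.2 zero_le_one)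

/-- Since 2 = (v, v) is the sum of the v_i (α_i, v), some simple root has positive product with v.
Either v is that simple root, or subtracting it is a reflection to a nonnegative vector of norm 2
and smaller height. -/
theorem isRoot_of_form : ∀ (n : ℕ) {v : I → ℤ}, form M v v = 2 → 0 ≤ v → ht v ≤ n → IsRoot M v
  | 0, v, h, h0, hn => by
    by_cases hv : v = 0
    · subst hv; simp [form] at h
    · have := ht_pos h0 hv; omega
  | n + 1, v, h, h0, hn => by
    obtain ⟨i, -, hi⟩ := exists_form_pos M h h0
    have h2 := form_simple_le_two M i h
    rcases (by omega : form M (simple i) v = 2 ∨ form M (simple i) v = 1) with h3 | h3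
    · rw [← eq_of_form_eq_two M (form_self M i) h h3.ge]
      exact IsRoot.simple i
    · have hr := isRoot_of_form n (form_sub_simple M h h3) (sub_simple_nonneg M h0 hi)
        (by rw [map_sub, ht_simple]; push_cast at hn; omega)
      have h4 : v = refl M i (v - simple i) := by
        rw [refl, form_sub_right, form_self, h3]
        norm_num
      rw [h4]
      exact IsRoot.refl i hr

theorem isPosRoot_iff {v : I → ℤ} : IsPosRoot M v ↔ form M v v = 2 ∧ 0 ≤ v :=
  ⟨fun h => ⟨form_self_of_isRoot M h.1, h.2⟩, fun h =>
    ⟨isRoot_of_form M (ht v).toNat h.1 h.2 (Int.self_le_toNat _), h.2⟩⟩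

variable {M}

theorem PosRoot.form_self (β : PosRoot M) : form M β.1 β.1 = 2 := ((isPosRoot_iff M).1 β.2).1

theorem PosRoot.ht_pos (β : PosRoot M) : 0 < ht β.1 :=
  GenLK.ht_pos β.2.2 fun h => by
    have := β.form_self
    rw [h] at this
    simp [form] at this

theorem PosRoot.exists_add {β : PosRoot M} {i : I} (h : form M (simple i) β.1 = -1) :
    ∃ γ : PosRoot M, γ.1 = β.1 + simple i :=
  ⟨⟨_, (isPosRoot_iff M).2 ⟨form_add_simple M β.form_self h, add_simple_nonneg i β.2.2⟩⟩, rfl⟩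

theorem PosRoot.exists_sub {β : PosRoot M} {i : I} (h : form M (simple i) β.1 = 1) :
    ∃ γ : PosRoot M, γ.1 = β.1 - simple i :=
  ⟨⟨_, (isPosRoot_iff M).2 ⟨form_sub_simple M β.form_self h,
    sub_simple_nonneg M β.2.2 (by omega)⟩⟩, rfl⟩

theorem PosRoot.neg_one_le (β : PosRoot M) (i : I) : -1 ≤ form M (simple i) β.1 := by
  have h := neg_two_le_form_simple M i β.form_self
  by_contra hn
  have h2 := eq_neg_of_form_eq_neg_two M (GenLK.form_self M i) β.form_self (by omega)
  have h3 := β.ht_pos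
  have h4 := congrArg ht h2
  rw [map_neg, ht_simple] at h4
  omega

theorem PosRoot.eq_simpleRoot {β : PosRoot M} {i : I} (h : form M (simple i) β.1 = 2) :
    β = simpleRoot M i :=
  Subtype.ext (eq_of_form_eq_two M (GenLK.form_self M i) β.form_self h.ge).symm

theorem PosRoot.form_cases (β : PosRoot M) (i : I) : β = simpleRoot M i ∨
    form M (simple i) β.1 = 1 ∨ form M (simple i) β.1 = 0 ∨ form M (simple i) β.1 = -1 := by
  have h1 := β.neg_one_le i
  have h2 := form_simple_le_two M i β.form_self
  rcases (by omega : form M (simple i) β.1 = 2 ∨ form M (simple i) β.1 = 1 ∨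
    form M (simple i) β.1 = 0 ∨ form M (simple i) β.1 = -1) with h | h | h | h
  · exact .inl (PosRoot.eq_simpleRoot h)
  · exact .inr (.inl h)
  · exact .inr (.inr (.inl h))
  · exact .inr (.inr (.inr h))

theorem PosRoot.exists_form_eq_one (β : PosRoot M) (hβ : ∀ i, β ≠ simpleRoot M i) :
    ∃ i, form M (simple i) β.1 = 1 := by
  obtain ⟨i, -, hi⟩ := exists_form_pos M β.form_self β.2.2
  rcases β.form_cases i with h | h | h | h
  · exact absurd h (hβ i)
  · exact ⟨i, h⟩
  · omega
  · omega

variable (M) in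
/-- The heights of the positive roots are bounded. -/
theorem exists_ht_le : ∃ B : ℤ, ∀ β : PosRoot M, ht β.1 ≤ B := by
  obtain ⟨u, hu, hc⟩ := FiniteType.exists_pos (M := M)
  -- By `mul_sq_le_mul_form` a coordinate of a root satisfies β_i ≤ β_i² ≤ 2u_i, as the integer
  -- (α_i, u) is at least 1.
  refine ⟨ht (fun i => 2 * u i), fun β => ht_le fun i => ?_⟩
  have h1 := mul_sq_le_mul_form M hu hc β.1 i
  rw [β.form_self] at h1
  have h2 := hc i
  have h3 : β.1 i ^ 2 ≤ u i * 2 := le_trans (by nlinarith [sq_nonneg (β.1 i)]) h1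
  have h4 := β.2.2 i
  simp only [Pi.zero_apply] at h4
  by_contra hn
  have := hu i
  nlinarith

/-- Induction over the positive roots, from the high ones to the low ones. -/
theorem PosRoot.induction_down {P : PosRoot M → Prop}
    (h : ∀ β, (∀ γ : PosRoot M, ht β.1 < ht γ.1 → P γ) → P β) (β : PosRoot M) : P β := by
  obtain ⟨B, hB⟩ := exists_ht_le M
  induction hn : (B - ht β.1).toNat using Nat.strong_induction_on generalizing β with
  | _ n ih =>
    refine h β fun γ hγ => ih _ ?_ γ rfl
    have := hB γ
    omega

/-- Induction over the positive roots, from the low ones to the high ones. -/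
theorem PosRoot.induction_up {P : PosRoot M → Prop}
    (h : ∀ β, (∀ γ : PosRoot M, ht γ.1 < ht β.1 → P γ) → P β) (β : PosRoot M) : P β := by
  induction hn : (ht β.1).toNat using Nat.strong_induction_on generalizing β with
  | _ n ih =>
    refine h β fun γ hγ => ih _ ?_ γ rfl
    have := γ.ht_pos
    omega

/-- The support is closed under adjacency: at a neighbour j of the support with coordinate 0, the
product (α_j, θ) would be negative. Connectedness does the rest. -/
theorem PosRoot.coord_pos_of_dominant {θ : PosRoot M} (h : ∀ i, 0 ≤ form M (simple i) θ.1)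
    (i : I) : 0 < θ.1 i := by
  have hS : {i | 0 < θ.1 i} = Set.univ := by
    refine FiniteType.connected (M := M) _ ?_ ?_
    · obtain ⟨i, hi, -⟩ := exists_form_pos M θ.form_self θ.2.2
      exact ⟨i, hi⟩
    · intro i j hi hij
      by_contra hj
      have hj0 : θ.1 j = 0 := le_antisymm (not_lt.1 hj) (θ.2.2 j)
      have h1 : form M (simple j) θ.1 < 0 := by
        rw [form_simple_left]
        refine Finset.sum_neg' (fun k _ => ?_) ⟨i, Finset.mem_univ i, ?_⟩
        · by_cases hjk : j = k
          · rw [← hjk, hj0, mul_zero]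
          · exact mul_nonpos_of_nonpos_of_nonneg (cartan_nonpos M hjk) (θ.2.2 k)
        · rw [cartan_of_adj M hij.symm]
          have : 0 < θ.1 i := hi
          omega
      exact absurd (h j) (not_le.2 h1)
  exact hS.ge (Set.mem_univ i)

/-- Full support makes (η, θ) positive. If it were 1, then θ - η would have norm 2 and hence be
positive or negative; but its product with η is -1 and with θ is 1, which contradicts dominance of η
or of θ. -/
theorem PosRoot.dominant_unique {θ η : PosRoot M} (h : ∀ i, 0 ≤ form M (simple i) θ.1)
    (h' : ∀ i, 0 ≤ form M (simple i) η.1) : θ = η := by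
  obtain ⟨i, hi, hi'⟩ := exists_form_pos M θ.form_self θ.2.2
  have hpos : 0 < form M η.1 θ.1 := by
    rw [form_eq_sum]
    exact Finset.sum_pos' (fun j _ => mul_nonneg (η.2.2 j) (h j))
      ⟨i, Finset.mem_univ i, mul_pos (PosRoot.coord_pos_of_dominant h' i) hi'⟩
  have hno : ∀ {θ η : PosRoot M}, (∀ i, 0 ≤ form M (simple i) η.1) →
      form M η.1 θ.1 = 1 → ¬ 0 ≤ θ.1 - η.1 := by
    intro θ η h hf h0
    have h1 : 0 ≤ form M (θ.1 - η.1) η.1 := by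
      rw [form_eq_sum]
      exact Finset.sum_nonneg fun j _ => mul_nonneg (h0 j) (h j)
    rw [form_sub_left, form_comm M θ.1, hf, η.form_self] at h1
    omega
  by_cases h2 : 2 ≤ form M η.1 θ.1
  · exact (Subtype.ext (eq_of_form_eq_two M η.form_self θ.form_self h2)).symm
  have h1 : form M η.1 θ.1 = 1 := by omega
  have h3 : form M (θ.1 - η.1) (θ.1 - η.1) = 2 := by
    simp only [form_sub_left, form_sub_right, form_comm M θ.1 η.1, h1, θ.form_self, η.form_self]
    norm_num
  rcases nonneg_or_nonpos M h3 with h4 | h4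
  · exact absurd h4 (hno h' h1)
  · exact absurd (by rw [← neg_sub]; exact neg_nonneg.2 h4)
      (hno h (by rw [form_comm]; exact h1))

theorem PosRoot.exists_dominant_ge : ∀ β : PosRoot M,
    ∃ θ : PosRoot M, (∀ i, 0 ≤ form M (simple i) θ.1) ∧ β.1 ≤ θ.1 :=
  PosRoot.induction_down fun β ih => by
    by_cases hβ : ∀ i, 0 ≤ form M (simple i) β.1
    · exact ⟨β, hβ, le_rfl⟩
    · push Not at hβ
      obtain ⟨i, hi⟩ := hβ
      obtain ⟨γ, hγ⟩ := PosRoot.exists_add (β := β) (i := i) (by have := β.neg_one_le i; omega)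
      obtain ⟨θ, hθ, hle⟩ := ih γ (by rw [hγ, map_add, ht_simple]; omega)
      have hβγ : β.1 ≤ γ.1 := by
        rw [hγ]
        exact le_add_of_nonneg_right (Pi.single_nonneg.2 zero_le_one)
      exact ⟨θ, hθ, hβγ.trans hle⟩

variable (M) in
theorem highestRoot_spec : IsPosRoot M (highestRoot M) ∧
    ∀ γ, IsPosRoot M γ → γ ≤ highestRoot M := by
  have h : ∃ θ, IsPosRoot M θ ∧ ∀ γ, IsPosRoot M γ → γ ≤ θ := by
    obtain ⟨i⟩ := FiniteType.nonempty (M := M)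
    obtain ⟨θ, hθ, -⟩ := (simpleRoot M i).exists_dominant_ge
    refine ⟨θ.1, θ.2, fun γ hγ => ?_⟩
    obtain ⟨η, hη, hle⟩ := PosRoot.exists_dominant_ge (⟨γ, hγ⟩ : PosRoot M)
    rw [PosRoot.dominant_unique hθ hη]
    exact hle
  rw [highestRoot, dif_pos h]
  exact h.choose_spec

variable (M) in
/-- The highest root as an element of `Φ⁺`. -/
def top : PosRoot M := ⟨highestRoot M, (highestRoot_spec M).1⟩

theorem PosRoot.le_top (β : PosRoot M) : β.1 ≤ (top M).1 := (highestRoot_spec M).2 _ β.2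

theorem top_dominant (i : I) : 0 ≤ form M (simple i) (top M).1 := by
  by_contra hn
  obtain ⟨γ, hγ⟩ := PosRoot.exists_add (β := top M) (i := i)
    (by have := (top M).neg_one_le i; omega)
  have := ht_le γ.le_top
  rw [hγ, map_add, ht_simple] at this
  omega

theorem PosRoot.exists_form_eq_neg_one {β : PosRoot M} (h : β ≠ top M) :
    ∃ i, form M (simple i) β.1 = -1 := by
  by_contra! hn
  refine h (PosRoot.dominant_unique (fun i => ?_) top_dominant)
  have := β.neg_one_le i
  have := hn i
  omega

end RootSystem

/-! ### Shortest words -/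

section Words

variable {I : Type*} [Fintype I] [DecidableEq I] {M : SimpleGraph I}

theorem refl_of_form_eq {i : I} {v : I → ℤ} {c : ℤ} (h : form M (simple i) v = c) :
    refl M i v = v - c • simple i := by rw [refl, h]

theorem refl_neg (i : I) (v : I → ℤ) : refl M i (-v) = -refl M i v := by
  simp only [refl, form_neg_right]
  module

theorem ht_refl (i : I) (v : I → ℤ) : ht (refl M i v) = ht v - form M (simple i) v := by
  rw [refl, map_sub, map_zsmul, ht_simple]; simp

theorem wordAct_cons (i : I) (ω : List I) (v : I → ℤ) :
    wordAct M (i :: ω) v = refl M i (wordAct M ω v) := rfl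

theorem form_wordAct (ω : List I) (v : I → ℤ) :
    form M (wordAct M ω v) (wordAct M ω v) = form M v v := by
  induction ω with
  | nil => rfl
  | cons i ω ih => rw [wordAct_cons, form_refl_refl, ih]

open Classical in
/-- The height, shifted by one on the negative roots: a simple reflection changes it by at
most one. -/
def shiftedHt (v : I → ℤ) : ℤ := if 0 ≤ v then ht v else ht v + 1

theorem shiftedHt_of_nonneg {v : I → ℤ} (h : 0 ≤ v) : shiftedHt v = ht v := if_pos h

theorem PosRoot.shiftedHt_neg [FiniteType M] (β : PosRoot M) :
    shiftedHt (-β.1) = -ht β.1 + 1 := by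
  rw [shiftedHt, if_neg, map_neg]
  intro h
  have h1 := ht_nonneg h
  have h2 := β.ht_pos
  rw [map_neg] at h1
  omega

theorem PosRoot.refl_mem [FiniteType M] {β : PosRoot M} {i : I} (h : β ≠ simpleRoot M i) :
    ∃ γ : PosRoot M, γ.1 = refl M i β.1 := by
  rcases β.form_cases i with h1 | h1 | h1 | h1
  · exact absurd h1 h
  · obtain ⟨γ, hγ⟩ := PosRoot.exists_sub h1
    exact ⟨γ, by rw [hγ, refl_of_form_eq h1, one_smul]⟩
  · exact ⟨β, by rw [refl_of_form_eq h1, zero_smul, sub_zero]⟩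
  · obtain ⟨γ, hγ⟩ := PosRoot.exists_add h1
    exact ⟨γ, by rw [hγ, refl_of_form_eq h1, neg_one_smul, sub_neg_eq_add]⟩

theorem refl_simple (i : I) : refl M i (simple i) = -simple i := by
  rw [refl_of_form_eq (form_self M i)]; module

theorem shiftedHt_le_refl [FiniteType M] (i : I) {v : I → ℤ} (h : form M v v = 2) :
    shiftedHt v ≤ shiftedHt (refl M i v) + 1 := by
  rcases nonneg_or_nonpos M h with h0 | h0
  · obtain ⟨β, rfl⟩ : ∃ β : PosRoot M, β.1 = v := ⟨⟨v, (isPosRoot_iff M).2 ⟨h, h0⟩⟩, rfl⟩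
    rw [shiftedHt_of_nonneg h0]
    by_cases hβ : β = simpleRoot M i
    · have h1 := (simpleRoot M i).shiftedHt_neg
      subst hβ
      change ht (simple i) ≤ shiftedHt (refl M i (simple i)) + 1
      change shiftedHt (-simple i) = -ht (simple i) + 1 at h1
      rw [refl_simple, h1, ht_simple]
      norm_num
    · obtain ⟨γ, hγ⟩ := PosRoot.refl_mem hβ
      rw [← hγ, shiftedHt_of_nonneg γ.2.2, hγ, ht_refl]
      rcases β.form_cases i with h1 | h1 | h1 | h1
      · exact absurd h1 hβ
      all_goals omega
  · obtain ⟨β, hβv⟩ : ∃ β : PosRoot M, β.1 = -v :=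
      ⟨⟨-v, (isPosRoot_iff M).2 ⟨by simp [form_neg_left, form_neg_right, h], by simpa using h0⟩⟩,
        rfl⟩
    obtain rfl : v = -β.1 := by rw [hβv, neg_neg]
    rw [β.shiftedHt_neg]
    by_cases hβ : β = simpleRoot M i
    · subst hβ
      change -ht (simple i) + 1 ≤ shiftedHt (refl M i (-simple i)) + 1
      rw [refl_neg, refl_simple, neg_neg,
        shiftedHt_of_nonneg (show 0 ≤ simple i from (simpleRoot M i).2.2), ht_simple]
      norm_num
    · obtain ⟨γ, hγ⟩ := PosRoot.refl_mem hβ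
      rw [refl_neg, ← hγ, γ.shiftedHt_neg, hγ, ht_refl]
      have := β.neg_one_le i
      omega

theorem shiftedHt_le_wordAct [FiniteType M] (ω : List I) {v : I → ℤ} (h : form M v v = 2) :
    shiftedHt v ≤ shiftedHt (wordAct M ω v) + ω.length := by
  induction ω with
  | nil => simp [wordAct]
  | cons i ω ih =>
    have h1 := shiftedHt_le_refl (M := M) i (v := wordAct M ω v) (by rw [form_wordAct, h])
    rw [wordAct_cons, List.length_cons]
    push_cast
    omega

variable [FiniteType M]

theorem ht_top_sub_le_length {ω : List I} {β : PosRoot M}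
    (h : wordAct M ω (highestRoot M) = β.1) : ht (top M).1 - ht β.1 ≤ ω.length := by
  have h1 := shiftedHt_le_wordAct ω (top M).form_self
  change _ ≤ shiftedHt (wordAct M ω (highestRoot M)) + _ at h1
  rw [h, shiftedHt_of_nonneg (top M).2.2, shiftedHt_of_nonneg β.2.2] at h1
  omega

theorem PosRoot.refl_eq_add {β γ : PosRoot M} {i : I} (h : form M (simple i) β.1 = -1)
    (hγ : γ.1 = β.1 + simple i) : refl M i γ.1 = β.1 := by
  have : γ.1 = refl M i β.1 := by
    rw [hγ, refl_of_form_eq h, neg_one_smul, sub_neg_eq_add]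
  rw [this, refl_refl]

theorem PosRoot.exists_word : ∀ β : PosRoot M, ∃ ω : List I,
    wordAct M ω (highestRoot M) = β.1 ∧ (ω.length : ℤ) = ht (top M).1 - ht β.1 :=
  PosRoot.induction_down fun β ih => by
    by_cases h : β = top M
    · subst h; exact ⟨[], rfl, by simp⟩
    · obtain ⟨i, hi⟩ := PosRoot.exists_form_eq_neg_one h
      obtain ⟨γ, hγ⟩ := PosRoot.exists_add hi
      have hht : ht γ.1 = ht β.1 + 1 := by rw [hγ, map_add, ht_simple]
      obtain ⟨ω, hω, hlen⟩ := ih γ (by omega)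
      refine ⟨i :: ω, ?_, ?_⟩
      · rw [wordAct_cons, hω, PosRoot.refl_eq_add hi hγ]
      · rw [List.length_cons]; push_cast; omega

/-- A simple reflection lowers the shifted height by at most one, which bounds the length from
below. Raising β by simple roots until it is dominant attains the bound, so minimality becomes an
equation for the length. -/
theorem isShortestWord_iff {ω : List I} {β : PosRoot M} : IsShortestWord M ω β.1 ↔
    wordAct M ω (highestRoot M) = β.1 ∧ (ω.length : ℤ) = ht (top M).1 - ht β.1 := by
  constructor
  · rintro ⟨h, hmin⟩
    refine ⟨h, le_antisymm ?_ (ht_top_sub_le_length h)⟩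
    obtain ⟨ω', h', hlen⟩ := β.exists_word
    rw [← hlen]
    exact_mod_cast hmin ω' h'
  · rintro ⟨h, hlen⟩
    refine ⟨h, fun ω' h' => ?_⟩
    have := ht_top_sub_le_length h'
    omega

theorem PosRoot.exists_isShortestWord (β : PosRoot M) : ∃ ω, IsShortestWord M ω β.1 := by
  obtain ⟨ω, h⟩ := β.exists_word
  exact ⟨ω, isShortestWord_iff.2 h⟩

theorem IsShortestWord.cons {ω : List I} {β γ : PosRoot M} {i : I}
    (h : IsShortestWord M ω γ.1) (hi : form M (simple i) β.1 = -1)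
    (hγ : γ.1 = β.1 + simple i) : IsShortestWord M (i :: ω) β.1 := by
  rw [isShortestWord_iff] at h ⊢
  have hht : ht γ.1 = ht β.1 + 1 := by rw [hγ, map_add, ht_simple]
  refine ⟨by rw [wordAct_cons, h.1, PosRoot.refl_eq_add hi hγ], ?_⟩
  rw [List.length_cons]; push_cast; omega

theorem IsShortestWord.of_cons {ω : List I} {β : PosRoot M} {i : I}
    (h : IsShortestWord M (i :: ω) β.1) : form M (simple i) β.1 = -1 ∧
      ∃ γ : PosRoot M, γ.1 = β.1 + simple i ∧ IsShortestWord M ω γ.1 := by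
  rw [isShortestWord_iff] at h
  obtain ⟨h1, h2⟩ := h
  rw [wordAct_cons] at h1
  have h3 : wordAct M ω (highestRoot M) = refl M i β.1 := by rw [← h1, refl_refl]
  rw [List.length_cons] at h2
  push_cast at h2
  -- Otherwise `ω` would map the highest root to -α_i, of shifted height 0, with two letters fewer
  -- than the height of the highest root. This is where the shift on negative roots matters.
  have hβ : β ≠ simpleRoot M i := by
    rintro rfl
    have h4 := shiftedHt_le_wordAct ω (top M).form_self
    change _ ≤ shiftedHt (wordAct M ω (highestRoot M)) + _ at h4
    have h5 := (simpleRoot M i).shiftedHt_neg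
    change shiftedHt (-simple i) = -ht (simple i) + 1 at h5
    change wordAct M ω (highestRoot M) = refl M i (simple i) at h3
    change _ = ht (top M).1 - ht (simple i) at h2
    rw [shiftedHt_of_nonneg (top M).2.2, h3, refl_simple, h5] at h4
    rw [ht_simple] at h2 h4
    omega
  obtain ⟨γ, hγ⟩ := PosRoot.refl_mem hβ
  rw [← hγ] at h3
  have h4 := ht_top_sub_le_length h3
  have h5 := β.neg_one_le i
  have h6 : ht γ.1 = ht β.1 - form M (simple i) β.1 := by rw [hγ, ht_refl]
  have h7 : form M (simple i) β.1 = -1 := by omega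
  refine ⟨h7, γ, ?_, isShortestWord_iff.2 ⟨h3, by omega⟩⟩
  rw [hγ, refl_of_form_eq h7, neg_one_smul, sub_neg_eq_add]

/-- If i and j were adjacent, adding α_i would give a positive root with product -2 with α_j. -/
theorem PosRoot.not_adj_of_form {β : PosRoot M} {i j : I} (hi : form M (simple i) β.1 = -1)
    (hj : form M (simple j) β.1 = -1) : ¬ M.Adj i j := by
  intro h
  obtain ⟨γ, hγ⟩ := PosRoot.exists_add hi
  have h1 := γ.neg_one_le j
  rw [hγ, form_add_right, hj, form_adj M h.symm] at h1
  omega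

theorem isShortestWord_top : IsShortestWord M [] (top M).1 := ⟨rfl, by simp⟩

/-- A product along a shortest word depends on the root only, provided that the factors belonging
to nonadjacent nodes commute. -/
theorem foldr_eq_of_isShortestWord {X : Type*} (F : I → X → X) (x₀ : X)
    (hF : ∀ i j, ¬ M.Adj i j → ∀ a, F i (F j a) = F j (F i a)) :
    ∀ (n : ℕ) (ω ω' : List I) (β : PosRoot M), ω.length = n → IsShortestWord M ω β.1 →
      IsShortestWord M ω' β.1 → ω.foldr F x₀ = ω'.foldr F x₀ := by
  intro n
  induction n with
  | zero =>
    intro ω ω' β hn h h'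
    obtain rfl := List.length_eq_zero_iff.1 hn
    have h1 := (isShortestWord_iff.1 h).2
    have h2 := (isShortestWord_iff.1 h').2
    rw [← h1] at h2
    obtain rfl := List.length_eq_zero_iff.1 (show ω'.length = 0 by exact_mod_cast h2)
    rfl
  | succ n ih =>
    intro ω ω' β hn h h'
    have hlen : ω'.length = n + 1 := by
      have h1 := (isShortestWord_iff.1 h).2
      have h2 := (isShortestWord_iff.1 h').2
      omega
    obtain ⟨i, ω, rfl⟩ := List.exists_cons_of_length_eq_add_one hn
    obtain ⟨j, ω', rfl⟩ := List.exists_cons_of_length_eq_add_one hlen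
    simp only [List.length_cons, Nat.add_right_cancel_iff] at hn hlen
    obtain ⟨hi, γ, hγ, hω⟩ := h.of_cons
    obtain ⟨hj, γ', hγ', hω'⟩ := h'.of_cons
    simp only [List.foldr_cons]
    by_cases hij : i = j
    · subst hij
      obtain rfl : γ = γ' := Subtype.ext (hγ.trans hγ'.symm)
      rw [ih ω ω' γ hn hω hω']
    -- The diamond: both words can be routed through a shortest word of β + α_i + α_j, so that only
    -- commutation of nonadjacent letters is needed, never a braid relation.
    · have hnadj := PosRoot.not_adj_of_form hi hj
      have hf := form_not_adj M hij hnadj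
      have hjγ : form M (simple j) γ.1 = -1 := by
        rw [hγ, form_add_right, hj, form_comm, hf]; rfl
      have hiγ' : form M (simple i) γ'.1 = -1 := by
        rw [hγ', form_add_right, hi, hf]; rfl
      obtain ⟨δ, hδ⟩ := PosRoot.exists_add hjγ
      have hδ' : δ.1 = γ'.1 + simple i := by rw [hδ, hγ, hγ']; abel
      obtain ⟨ω'', h''⟩ := δ.exists_isShortestWord
      rw [ih ω (j :: ω'') γ hn hω (h''.cons hjγ hδ),
        ih ω' (i :: ω'') γ' hlen hω' (h''.cons hiγ' hδ')]
      exact hF i j hnadj _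

end Words

/-! ### The Artin group and its action by reflections -/

section ArtinGroup

variable {I : Type*} {M : SimpleGraph I}

theorem s_comm {i j : I} (h : ¬ M.Adj i j) : s M i * s M j = s M j * s M i := by
  rw [← mul_inv_eq_one]
  exact PresentedGroup.one_of_mem (ArtinRel.comm i j h)

theorem s_braid {i j : I} (h : M.Adj i j) : s M i * s M j * s M i = s M j * s M i * s M j := by
  rw [← mul_inv_eq_one]
  exact PresentedGroup.one_of_mem (ArtinRel.braid i j h)

/-- A family of elements of a group that satisfies the braid relations extends to the Artin
group. -/
def Artin.lift {G : Type*} [Group G] (f : I → G) (hc : ∀ i j, ¬ M.Adj i j → f i * f j = f j * f i)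
    (hb : ∀ i j, M.Adj i j → f i * f j * f i = f j * f i * f j) : Artin M →* G :=
  PresentedGroup.toGroup (f := f) (by
    rintro _ (⟨i, j, h⟩ | ⟨i, j, h⟩)
    · simpa only [map_mul, map_inv, FreeGroup.lift_apply_of, mul_inv_eq_one] using hc i j h
    · simpa only [map_mul, map_inv, FreeGroup.lift_apply_of, mul_inv_eq_one] using hb i j h)

@[simp] theorem Artin.lift_s {G : Type*} [Group G] (f : I → G)
    (hc : ∀ i j, ¬ M.Adj i j → f i * f j = f j * f i)
    (hb : ∀ i j, M.Adj i j → f i * f j * f i = f j * f i * f j) (i : I) :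
    Artin.lift f hc hb (s M i) = f i :=
  PresentedGroup.toGroup.of _

variable [Fintype I] [DecidableEq I]

variable (M) in
/-- The simple reflection as a permutation. -/
def reflEquiv (i : I) : Equiv.Perm (I → ℤ) :=
  ⟨refl M i, refl M i, refl_refl M i, refl_refl M i⟩

theorem reflEquiv_comm {i j : I} (h : ¬ M.Adj i j) :
    reflEquiv M i * reflEquiv M j = reflEquiv M j * reflEquiv M i := by
  by_cases hij : i = j
  · rw [hij]
  ext1 v
  change refl M i (refl M j v) = refl M j (refl M i v)
  simp only [refl, form_sub_right, form_smul_right, form_not_adj M hij h,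
    form_comm M (simple j) (simple i)]
  module

theorem reflEquiv_braid {i j : I} (h : M.Adj i j) :
    reflEquiv M i * reflEquiv M j * reflEquiv M i =
      reflEquiv M j * reflEquiv M i * reflEquiv M j := by
  ext1 v
  change refl M i (refl M j (refl M i v)) = refl M j (refl M i (refl M j v))
  simp only [refl, form_sub_right, form_smul_right, form_adj M h, form_self,
    form_comm M (simple j) (simple i)]
  module

variable (M) in
/-- The action of the Artin group by reflections. -/
def reflHom : Artin M →* Equiv.Perm (I → ℤ) :=
  Artin.lift (reflEquiv M) (fun _ _ => reflEquiv_comm) (fun _ _ => reflEquiv_braid)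

theorem s_injective : Function.Injective (s M) := by
  intro i j h
  have h1 := congrArg (fun a => reflHom M a (simple i) i) h
  simp only [reflHom, Artin.lift_s] at h1
  change refl M i (simple i) i = refl M j (simple i) i at h1
  by_contra hij
  simp only [refl, form_self, Pi.sub_apply, Pi.smul_apply, smul_eq_mul] at h1
  simp [simple, hij] at h1

/-- The action by reflections separates the two cases. This converse of the defining relation
transports relations between s_i and s_j to the nodes of C whose generators are their conjugates
under d_β. -/
theorem not_adj_of_s_comm {i j : I} (h : s M i * s M j = s M j * s M i) : ¬ M.Adj i j := by
  intro hij
  have h1 := congrArg (fun a => reflHom M a (simple i) j) h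
  simp only [map_mul, reflHom, Artin.lift_s] at h1
  change refl M i (refl M j (simple i)) j = refl M j (refl M i (simple i)) j at h1
  simp only [refl, form_sub_right, form_smul_right, form_self, form_adj M hij,
    form_comm M (simple j) (simple i), Pi.sub_apply, Pi.smul_apply, smul_eq_mul] at h1
  simp [simple, hij.ne'] at h1

theorem adj_of_s_braid {i j : I} (hij : i ≠ j)
    (h : s M i * s M j * s M i = s M j * s M i * s M j) : M.Adj i j := by
  by_contra hn
  rw [s_comm hn, mul_assoc, mul_assoc, mul_right_inj, mul_right_inj] at h
  exact hij (s_injective h)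

end ArtinGroup

/-! ### The elements `h_{β,i}` -/

section HeckeElements

variable {I : Type*} [Fintype I] [DecidableEq I] {M : SimpleGraph I} [FiniteType M]

theorem foldr_mul_eq_prod (ω : List I) :
    ω.foldr (fun i a => s M i * a) 1 = (ω.map (s M)).prod := by
  induction ω with
  | nil => rfl
  | cons i ω ih => simp [ih]

theorem d_eq_prod {ω : List I} {β : PosRoot M} (h : IsShortestWord M ω β.1) :
    d M β = (ω.map (s M)).prod := by
  have H := β.exists_isShortestWord
  rw [d, dif_pos H, ← foldr_mul_eq_prod, ← foldr_mul_eq_prod]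
  refine foldr_eq_of_isShortestWord _ _ (fun i j hij a => ?_) _ _ _ β rfl H.choose_spec h
  rw [← mul_assoc, s_comm hij, mul_assoc]

variable (M) in
theorem d_top : d M (top M) = 1 := d_eq_prod isShortestWord_top

theorem d_add {β γ : PosRoot M} {i : I} (hi : form M (simple i) β.1 = -1)
    (hγ : γ.1 = β.1 + simple i) : d M β = s M i * d M γ := by
  obtain ⟨ω, h⟩ := γ.exists_isShortestWord
  rw [d_eq_prod h, d_eq_prod (h.cons hi hγ)]
  simp

theorem hArtin_add {β γ : PosRoot M} {i k : I} (hk : form M (simple k) β.1 = -1)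
    (hγ : γ.1 = β.1 + simple k) (hik : ¬ M.Adj i k) : hArtin M β i = hArtin M γ i := by
  rw [hArtin, hArtin, d_add hk hγ]
  have := s_comm hik
  rw [mul_inv_rev, mul_assoc, mul_assoc, ← mul_assoc (s M i), this]
  simp [mul_assoc]

/-- Here d_β = s_j s_i d_δ, and s_i s_j s_i = s_j s_i s_j turns s_i on the left of s_j s_i into s_j
on its right. -/
theorem hArtin_sub_sub {β δ : PosRoot M} {i j : I} (hi : form M (simple i) δ.1 = 1)
    (hj : form M (simple j) δ.1 = 0) (hij : M.Adj i j)
    (hβ : β.1 = δ.1 - simple i - simple j) : hArtin M β i = hArtin M δ j := by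
  obtain ⟨γ, hγ⟩ := PosRoot.exists_sub hi
  have h1 : form M (simple i) γ.1 = -1 := by
    rw [hγ, form_sub_right, hi, form_self]; rfl
  have h2 : form M (simple j) β.1 = -1 := by
    rw [hβ, form_sub_right, form_sub_right, hj, form_self, form_adj M hij.symm]; rfl
  have h3 : d M β = s M j * (s M i * d M δ) := by
    rw [d_add h2 (γ := γ) (by rw [hβ, hγ]; abel), d_add h1 (γ := δ) (by rw [hγ]; abel)]
  have h4 : s M j * (s M i * s M j) = s M i * (s M j * s M i) := by
    simpa [mul_assoc] using (s_braid hij).symm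
  have h5 : s M i * (s M j * (s M i * d M δ)) = s M j * (s M i * (s M j * d M δ)) := by
    simp only [← mul_assoc]
    rw [s_braid hij]
  rw [hArtin, hArtin, h3, mul_assoc, h5]
  simp [mul_assoc]

/-- At the highest root d is trivial and i itself lies in C. Below it, raise β by some α_k: if k and
i are not adjacent, nothing changes; if they are, the pair (β, i) is replaced by (β + α_k + α_i, k).
-/
theorem exists_hArtin_eq : ∀ (β : PosRoot M) (i : I), form M (simple i) β.1 = 0 →
    ∃ j : C M, hArtin M β i = s M j :=
  PosRoot.induction_down fun β ih i hi => by
    by_cases h : β = top M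
    · subst h
      exact ⟨⟨i, hi⟩, by simp [hArtin, d_top]⟩
    obtain ⟨k, hk⟩ := PosRoot.exists_form_eq_neg_one h
    obtain ⟨γ, hγ⟩ := PosRoot.exists_add hk
    have hht : ht γ.1 = ht β.1 + 1 := by rw [hγ, map_add, ht_simple]
    by_cases hik : M.Adj i k
    · have h1 : form M (simple i) γ.1 = -1 := by
        rw [hγ, form_add_right, hi, form_adj M hik]; rfl
      obtain ⟨δ, hδ⟩ := PosRoot.exists_add h1
      have hht' : ht δ.1 = ht γ.1 + 1 := by rw [hδ, map_add, ht_simple]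
      have h2 : form M (simple k) δ.1 = 0 := by
        rw [hδ, hγ, form_add_right, form_add_right, hk, form_self, form_adj M hik.symm]; rfl
      have h3 : form M (simple i) δ.1 = 1 := by
        rw [hδ, form_add_right, h1, form_self]; rfl
      obtain ⟨j, hj⟩ := ih δ (by omega) k h2
      exact ⟨j, by rw [hArtin_sub_sub h3 h2 hik (by rw [hδ, hγ]; abel), hj]⟩
    · have hik' : i ≠ k := by rintro rfl; omega
      have h1 : form M (simple i) γ.1 = 0 := by
        rw [hγ, form_add_right, hi, form_not_adj M hik' hik]; rfl
      obtain ⟨j, hj⟩ := ih γ (by omega) i h1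
      exact ⟨j, by rw [hArtin_add hk hγ hik, hj]⟩

theorem h_congr {β γ : PosRoot M} {i j : I} (H : hArtin M β i = hArtin M γ j) :
    h M β i = h M γ j := by
  classical
  have : ∀ a b : Artin M, a = b → (if H : ∃ j : C M, a = s M j then z M H.choose else 0) =
      if H : ∃ j : C M, b = s M j then z M H.choose else 0 := by
    rintro a _ rfl
    rfl
  exact this _ _ H

theorem exists_h_eq {β : PosRoot M} {i : I} (hi : form M (simple i) β.1 = 0) :
    ∃ j : C M, hArtin M β i = s M j ∧ h M β i = z M j := by
  have H := exists_hArtin_eq β i hi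
  exact ⟨H.choose, H.choose_spec, by rw [h, dif_pos H]⟩

variable (M) in
/-- The element `m` of the Hecke algebra. -/
abbrev mZ : Z₀ M := algebraMap R₀ (Z₀ M) m₀

theorem mZ_comm (a : Z₀ M) : mZ M * a = a * mZ M := Algebra.commutes _ _

theorem z_quad (j : C M) : z M j * z M j = 1 - mZ M * z M j := by
  have h1 := RingQuot.mkAlgHom_rel R₀ (HeckeRel.quad (G := M.induce (C M)) (q := m₀) j)
  simp only [map_sub, map_add, map_mul, map_smul, map_one, map_zero] at h1
  change z M j * z M j + m₀ • z M j - 1 = 0 at h1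
  rw [Algebra.smul_def] at h1
  rw [eq_sub_iff_add_eq]
  exact sub_eq_zero.1 h1

theorem z_comm {j k : C M} (hjk : ¬ M.Adj j k) : z M j * z M k = z M k * z M j := by
  have h1 := RingQuot.mkAlgHom_rel R₀ (HeckeRel.comm (G := M.induce (C M)) (q := m₀) j k hjk)
  simp only [map_mul] at h1
  exact h1

theorem z_braid {j k : C M} (hjk : M.Adj j k) :
    z M j * z M k * z M j = z M k * z M j * z M k := by
  have h1 := RingQuot.mkAlgHom_rel R₀ (HeckeRel.braid (G := M.induce (C M)) (q := m₀) j k hjk)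
  simp only [map_mul] at h1
  exact h1

theorem h_quad {β : PosRoot M} {i : I} (hi : form M (simple i) β.1 = 0) :
    h M β i * h M β i = 1 - mZ M * h M β i := by
  obtain ⟨j, -, hj⟩ := exists_h_eq hi
  rw [hj, z_quad]

theorem hInv_mul_h {β : PosRoot M} {i : I} (hi : form M (simple i) β.1 = 0) :
    hInv M β i * h M β i = 1 := by
  rw [hInv, add_mul, h_quad hi]; abel

theorem h_mul_hInv {β : PosRoot M} {i : I} (hi : form M (simple i) β.1 = 0) :
    h M β i * hInv M β i = 1 := by
  rw [hInv, mul_add, h_quad hi, ← mZ_comm]; abel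

/-- Conjugation by d_β carries the relation between s_i and s_j to the generators indexed by C. The
reflection action then determines whether those nodes are adjacent, hence which relation holds in
the Hecke algebra; `h_braid` is the adjacent case. -/
theorem h_comm {β : PosRoot M} {i j : I} (hi : form M (simple i) β.1 = 0)
    (hj : form M (simple j) β.1 = 0) (hij : ¬ M.Adj i j) :
    h M β i * h M β j = h M β j * h M β i := by
  obtain ⟨a, ha, ha'⟩ := exists_h_eq hi
  obtain ⟨b, hb, hb'⟩ := exists_h_eq hj
  rw [ha', hb']
  refine z_comm (not_adj_of_s_comm ?_)
  rw [← ha, ← hb, hArtin, hArtin]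
  have := s_comm hij
  simp only [mul_assoc, mul_inv_cancel_left, mul_right_inj]
  rw [← mul_assoc, this, mul_assoc]

theorem h_braid {β : PosRoot M} {i j : I} (hi : form M (simple i) β.1 = 0)
    (hj : form M (simple j) β.1 = 0) (hij : M.Adj i j) :
    h M β i * h M β j * h M β i = h M β j * h M β i * h M β j := by
  obtain ⟨a, ha, ha'⟩ := exists_h_eq hi
  obtain ⟨b, hb, hb'⟩ := exists_h_eq hj
  rw [ha', hb']
  refine z_braid (adj_of_s_braid ?_ ?_)
  · intro hab
    rw [hab, ← hb, hArtin, hArtin] at ha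
    exact hij.ne (s_injective (by simpa using ha))
  · rw [← ha, ← hb, hArtin, hArtin]
    have := s_braid hij
    simp only [mul_assoc] at this
    simp only [mul_assoc, mul_inv_cancel_left, mul_right_inj]
    simp only [← mul_assoc] at this ⊢
    rw [this]

theorem h_add {β γ : PosRoot M} {i k : I} (hk : form M (simple k) β.1 = -1)
    (hγ : γ.1 = β.1 + simple k) (hik : ¬ M.Adj i k) : h M β i = h M γ i :=
  h_congr (hArtin_add hk hγ hik)

theorem h_sub_sub {β δ : PosRoot M} {i j : I} (hi : form M (simple i) δ.1 = 1)
    (hj : form M (simple j) δ.1 = 0) (hij : M.Adj i j)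
    (hβ : β.1 = δ.1 - simple i - simple j) : h M β i = h M δ j :=
  h_congr (hArtin_sub_sub hi hj hij hβ)

end HeckeElements

/-! ### The representation `τ` of the Artin monoid -/

section Tau

variable {I : Type*} [Fintype I] [DecidableEq I] {M : SimpleGraph I}

theorem ext_xv {N : Type*} [AddCommGroup N] [Module (Z₀ M)ᵐᵒᵖ N] {f g : V₀ M →ₗ[(Z₀ M)ᵐᵒᵖ] N}
    (H : ∀ β, f (xv M β) = g (xv M β)) : f = g := by
  refine Finsupp.lhom_ext fun β a => ?_
  have : (Finsupp.single β a : V₀ M) = op a • xv M β := by simp [xv]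
  rw [this, map_smul, map_smul, H]

theorem smul_R₀_eq (r : R₀) (v : V₀ M) : r • v = op (algebraMap R₀ (Z₀ M) r) • v := by
  ext β
  rw [Finsupp.smul_apply, Finsupp.smul_apply, op_smul_eq_mul, Algebra.smul_def, Algebra.commutes]

theorem xv'_eq {v : I → ℤ} {γ : PosRoot M} (hγ : γ.1 = v) : xv' M v = xv M γ := by
  subst hγ
  rw [xv', dif_pos γ.2]

theorem tau_self (i : I) : tau M i (xv M (simpleRoot M i)) = 0 := by
  rw [tau, ofBasis_xv, if_pos (by exact form_self M i)]

theorem tau_sub {i : I} {β γ : PosRoot M} (hi : form M (simple i) β.1 = 1)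
    (hγ : γ.1 = β.1 - simple i) : tau M i (xv M β) = xv M γ := by
  rw [tau, ofBasis_xv, hi, if_neg (by norm_num), if_pos rfl, xv'_eq hγ]

theorem tau_zero {i : I} {β : PosRoot M} (hi : form M (simple i) β.1 = 0) :
    tau M i (xv M β) = op (h M β i) • xv M β := by
  rw [tau, ofBasis_xv, hi, if_neg (by norm_num), if_neg (by norm_num), if_pos rfl]

theorem tau_add {i : I} {β γ : PosRoot M} (hi : form M (simple i) β.1 = -1)
    (hγ : γ.1 = β.1 + simple i) :
    tau M i (xv M β) = xv M γ - op (mZ M) • xv M β := by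
  rw [tau, ofBasis_xv, hi, if_neg (by norm_num), if_neg (by norm_num), if_neg (by norm_num),
    if_pos rfl, xv'_eq hγ, smul_R₀_eq]

theorem form_add_of_not_adj {i j : I} (hij : i ≠ j) (hn : ¬ M.Adj i j) {v w : I → ℤ} {c : ℤ}
    (hi : form M (simple i) v = c) (hw : w = v + simple j) : form M (simple i) w = c := by
  rw [hw, form_add_right, hi, form_not_adj M hij hn, add_zero]

theorem form_sub_of_not_adj {i j : I} (hij : i ≠ j) (hn : ¬ M.Adj i j) {v w : I → ℤ} {c : ℤ}
    (hi : form M (simple i) v = c) (hw : w = v - simple j) : form M (simple i) w = c := by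
  rw [hw, form_sub_right, hi, form_not_adj M hij hn, sub_zero]

theorem form_add_of_adj {i j : I} (hn : M.Adj i j) {v w : I → ℤ} {c : ℤ}
    (hi : form M (simple i) v = c) (hw : w = v + simple j) : form M (simple i) w = c - 1 := by
  rw [hw, form_add_right, hi, form_adj M hn]; ring

theorem form_sub_of_adj {i j : I} (hn : M.Adj i j) {v w : I → ℤ} {c : ℤ}
    (hi : form M (simple i) v = c) (hw : w = v - simple j) : form M (simple i) w = c + 1 := by
  rw [hw, form_sub_right, hi, form_adj M hn]; ring

theorem form_add_of_self {i : I} {v w : I → ℤ} {c : ℤ}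
    (hi : form M (simple i) v = c) (hw : w = v + simple i) : form M (simple i) w = c + 2 := by
  rw [hw, form_add_right, hi, form_self]

theorem form_sub_of_self {i : I} {v w : I → ℤ} {c : ℤ}
    (hi : form M (simple i) v = c) (hw : w = v - simple i) : form M (simple i) w = c - 2 := by
  rw [hw, form_sub_right, hi, form_self]

variable [FiniteType M]

/-- The hypothesis selects one representative of each pair of products with α_i and α_j up to
exchanging i and j; `tau_comm` covers the rest by symmetry. -/
theorem tau_comm_aux {i j : I} (hij : i ≠ j) (hn : ¬ M.Adj i j) {β : PosRoot M}
    (h' : β = simpleRoot M i ∨ form M (simple i) β.1 = 1 ∨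
      (form M (simple i) β.1 = 0 ∧ form M (simple j) β.1 ≤ 0) ∨
      (form M (simple i) β.1 = -1 ∧ form M (simple j) β.1 = -1)) :
    tau M i (tau M j (xv M β)) = tau M j (tau M i (xv M β)) := by
  have hn' : ¬ M.Adj j i := fun h => hn h.symm
  rcases h' with rfl | hi | ⟨hi, hj⟩ | ⟨hi, hj⟩
  · have hj : form M (simple j) (simpleRoot M i).1 = 0 := form_not_adj M hij.symm hn'
    rw [tau_self, map_zero, tau_zero hj, map_smul, tau_self, smul_zero]
  · obtain ⟨γ, hγ⟩ := PosRoot.exists_sub hi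
    rw [tau_sub hi hγ]
    rcases β.form_cases j with rfl | hj | hj | hj
    · change form M (simple i) (simple j) = 1 at hi
      rw [form_not_adj M hij hn] at hi
      omega
    · have hjγ := form_sub_of_not_adj hij.symm hn' hj hγ
      obtain ⟨δ, hδ⟩ := PosRoot.exists_sub hj
      obtain ⟨ε, hε⟩ := PosRoot.exists_sub hjγ
      rw [tau_sub hj hδ, tau_sub hjγ hε, tau_sub (form_sub_of_not_adj hij hn hi hδ)]
      rw [hε, hδ, hγ]; abel
    · have hjγ := form_sub_of_not_adj hij.symm hn' hj hγ
      have hiγ := form_sub_of_self hi hγ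
      rw [tau_zero hj, map_smul, tau_sub hi hγ, tau_zero hjγ,
        h_add (β := γ) (γ := β) hiγ (by rw [hγ]; abel) hn']
    · have hjγ := form_sub_of_not_adj hij.symm hn' hj hγ
      obtain ⟨δ, hδ⟩ := PosRoot.exists_add hj
      obtain ⟨ε, hε⟩ := PosRoot.exists_add hjγ
      rw [tau_add hj hδ, tau_add hjγ hε, map_sub, map_smul, tau_sub hi hγ,
        tau_sub (form_add_of_not_adj hij hn hi hδ)]
      rw [hε, hδ, hγ]; abel
  · rw [tau_zero hi, map_smul]
    rcases β.form_cases j with rfl | hj | hj | hj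
    · have := form_self M j
      change form M (simple j) (simple j) ≤ 0 at hj
      omega
    · omega
    · rw [tau_zero hj, map_smul, tau_zero hi, smul_smul, smul_smul, ← op_mul, ← op_mul,
        h_comm hi hj hn]
    · obtain ⟨δ, hδ⟩ := PosRoot.exists_add hj
      rw [tau_add hj hδ, map_sub, map_smul, tau_zero hi,
        tau_zero (form_add_of_not_adj hij hn hi hδ), h_add hj hδ hn, smul_sub, smul_smul, smul_smul,
        ← op_mul, ← op_mul, mZ_comm]
  · obtain ⟨γ, hγ⟩ := PosRoot.exists_add hi
    obtain ⟨δ, hδ⟩ := PosRoot.exists_add hj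
    have hjγ := form_add_of_not_adj hij.symm hn' hj hγ
    have hiδ := form_add_of_not_adj hij hn hi hδ
    obtain ⟨ε, hε⟩ := PosRoot.exists_add hjγ
    have hε' : ε.1 = δ.1 + simple i := by rw [hε, hδ, hγ]; abel
    rw [tau_add hi hγ, tau_add hj hδ, map_sub, map_sub, map_smul, map_smul, tau_add hi hγ,
      tau_add hj hδ, tau_add hjγ hε, tau_add hiδ hε', smul_sub, smul_sub]
    abel

theorem tau_comm {i j : I} (hn : ¬ M.Adj i j) : tau M i * tau M j = tau M j * tau M i := by
  by_cases hij : i = j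
  · rw [hij]
  have hn' : ¬ M.Adj j i := fun h => hn h.symm
  refine ext_xv fun β => ?_
  simp only [Module.End.mul_apply]
  rcases β.form_cases i with hi | hi | hi | hi
  · exact tau_comm_aux hij hn (.inl hi)
  · exact tau_comm_aux hij hn (.inr (.inl hi))
  · rcases β.form_cases j with hj | hj | hj | hj
    · exact (tau_comm_aux (Ne.symm hij) hn' (.inl hj)).symm
    · exact (tau_comm_aux (Ne.symm hij) hn' (.inr (.inl hj))).symm
    · exact tau_comm_aux hij hn (.inr (.inr (.inl ⟨hi, hj.le⟩)))
    · exact tau_comm_aux hij hn (.inr (.inr (.inl ⟨hi, by omega⟩)))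
  · rcases β.form_cases j with hj | hj | hj | hj
    · exact (tau_comm_aux (Ne.symm hij) hn' (.inl hj)).symm
    · exact (tau_comm_aux (Ne.symm hij) hn' (.inr (.inl hj))).symm
    · exact (tau_comm_aux (Ne.symm hij) hn' (.inr (.inr (.inl ⟨hj, by omega⟩)))).symm
    · exact tau_comm_aux hij hn (.inr (.inr (.inr ⟨hi, hj⟩)))

/-- The pairs of products with adjacent simple roots, up to the order of the two roots. -/
theorem tau_braid_aux {i j : I} (hij : M.Adj i j) {β : PosRoot M}
    (h' : β = simpleRoot M i ∨ form M (simple i) β.1 = 1 ∨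
      (form M (simple i) β.1 = 0 ∧ form M (simple j) β.1 ≤ 0)) :
    tau M i (tau M j (tau M i (xv M β))) = tau M j (tau M i (tau M j (xv M β))) := by
  rcases h' with rfl | hi | ⟨hi, hj⟩
  · have hj : form M (simple j) (simpleRoot M i).1 = -1 := form_adj M hij.symm
    obtain ⟨γ, hγ⟩ := PosRoot.exists_add hj
    have h1 := form_add_of_adj hij (form_self M i) hγ
    rw [tau_self, map_zero, map_zero, tau_add hj hγ, map_sub, map_smul, tau_self, smul_zero,
      sub_zero, tau_sub h1 (γ := simpleRoot M j), tau_self]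
    rw [hγ]
    change simple j = simple i + simple j - simple i
    abel
  · obtain ⟨γ, hγ⟩ := PosRoot.exists_sub hi
    rw [tau_sub hi hγ]
    have hiγ := form_sub_of_self hi hγ
    rcases β.form_cases j with rfl | hj | hj | hj
    · change form M (simple i) (simple j) = 1 at hi
      rw [form_adj M hij] at hi
      omega
    · have hjγ := PosRoot.eq_simpleRoot (form_sub_of_adj hij.symm hj hγ)
      obtain ⟨δ, hδ⟩ := PosRoot.exists_sub hj
      have hiδ := PosRoot.eq_simpleRoot (form_sub_of_adj hij hi hδ)
      rw [tau_sub hj hδ, hjγ, hiδ, tau_self, tau_self, map_zero, map_zero]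
    · have hjγ := form_sub_of_adj hij.symm hj hγ
      obtain ⟨δ, hδ⟩ := PosRoot.exists_sub hjγ
      have hiδ := form_sub_of_adj hij hiγ hδ
      rw [tau_sub hjγ hδ, tau_zero hiδ, tau_zero hj, map_smul, map_smul, tau_sub hi hγ,
        tau_sub hjγ hδ, h_sub_sub hi hj hij (by rw [hδ, hγ])]
    · have hjγ := form_sub_of_adj hij.symm hj hγ
      obtain ⟨δ, hδ⟩ := PosRoot.exists_add hj
      have hiδ := form_add_of_adj hij hi hδ
      have hjδ := form_add_of_self hj hδ
      have hβγ : β.1 = γ.1 + simple i := by rw [hγ]; abel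
      have hβδ : β.1 = δ.1 - simple j := by rw [hδ]; abel
      rw [tau_zero hjγ, map_smul, tau_add hiγ hβγ, tau_add hj hδ, map_sub, map_smul, tau_sub hi hγ,
        tau_zero hiδ, map_sub, map_smul, map_smul, tau_sub hjδ hβδ, tau_zero hjγ,
        h_sub_sub hjδ hiδ hij.symm (by rw [hδ, hγ]; abel), smul_sub, smul_smul, smul_smul,
        ← op_mul, ← op_mul, mZ_comm]
  · rcases β.form_cases j with rfl | hj | hj | hj
    · have := form_self M j
      change form M (simple j) (simple j) ≤ 0 at hj
      omega
    · omega
    · simp only [tau_zero hi, tau_zero hj, map_smul, smul_smul, ← op_mul, ← mul_assoc]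
      rw [h_braid hi hj hij]
    · obtain ⟨γ, hγ⟩ := PosRoot.exists_add hj
      have hjγ := form_add_of_self hj hγ
      have hiγ := form_add_of_adj hij hi hγ
      obtain ⟨δ, hδ⟩ := PosRoot.exists_add (β := γ) (i := i) (by omega)
      have hjδ := form_add_of_adj hij.symm hjγ hδ
      have hiδ := form_add_of_self hiγ hδ
      have hβγ : β.1 = γ.1 - simple j := by rw [hγ]; abel
      have hh : h M β i = h M δ j := h_sub_sub (by omega) (by omega) hij (by rw [hδ, hγ]; abel)
      -- The only case of the braid relation that needs the quadratic relation of the Hecke algebra.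
      have h2 : h M δ j * (mZ M * mZ M) = mZ M - h M δ j * (h M δ j * mZ M) := by
        rw [← hh, ← mul_assoc, ← mul_assoc, h_quad hi, ← mZ_comm]; noncomm_ring
      simp only [tau_zero hi, tau_add hj hγ, tau_add (show form M (simple i) γ.1 = -1 by omega) hδ,
        tau_zero (show form M (simple j) δ.1 = 0 by omega),
        tau_sub (show form M (simple j) γ.1 = 1 by omega) hβγ, map_sub, map_smul, smul_sub,
        smul_smul, ← op_mul, hh, mZ_comm, mul_assoc]
      rw [h2, op_sub, sub_smul]
      abel

theorem tau_braid {i j : I} (hij : M.Adj i j) :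
    tau M i * tau M j * tau M i = tau M j * tau M i * tau M j := by
  refine ext_xv fun β => ?_
  simp only [Module.End.mul_apply]
  rcases β.form_cases i with hi | hi | hi | hi
  · exact tau_braid_aux hij (.inl hi)
  · exact tau_braid_aux hij (.inr (.inl hi))
  · rcases β.form_cases j with hj | hj | hj | hj
    · exact (tau_braid_aux hij.symm (.inl hj)).symm
    · exact (tau_braid_aux hij.symm (.inr (.inl hj))).symm
    · exact tau_braid_aux hij (.inr (.inr ⟨hi, hj.le⟩))
    · exact tau_braid_aux hij (.inr (.inr ⟨hi, by omega⟩))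
  · rcases β.form_cases j with hj | hj | hj | hj
    · exact (tau_braid_aux hij.symm (.inl hj)).symm
    · exact (tau_braid_aux hij.symm (.inr (.inl hj))).symm
    · exact (tau_braid_aux hij.symm (.inr (.inr ⟨hj, by omega⟩))).symm
    · exact absurd hij (PosRoot.not_adj_of_form hi hj)

/-- The quadratic relation holds for `τ_i` up to the projection on `x_{α_i}`. -/
theorem tau_tau_xv {i : I} {β : PosRoot M} (hβ : β ≠ simpleRoot M i) :
    tau M i (tau M i (xv M β)) = xv M β - op (mZ M) • tau M i (xv M β) := by
  rcases β.form_cases i with hi | hi | hi | hi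
  · exact absurd hi hβ
  · obtain ⟨γ, hγ⟩ := PosRoot.exists_sub hi
    have hiγ := form_sub_of_self hi hγ
    rw [tau_sub hi hγ, tau_add hiγ (γ := β) (by rw [hγ]; abel)]
  · rw [tau_zero hi, map_smul, tau_zero hi, smul_smul, smul_smul, ← op_mul, ← op_mul, h_quad hi,
      op_sub, sub_smul, op_one, one_smul, mZ_comm]
  · obtain ⟨γ, hγ⟩ := PosRoot.exists_add hi
    have hiγ := form_add_of_self hi hγ
    rw [tau_add hi hγ, map_sub, map_smul, tau_sub hiγ (γ := β) (by rw [hγ]; abel), tau_add hi hγ]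

end Tau

/-! ### The functionals `φ_β` -/

section Functionals

variable {I : Type*} [Fintype I] [DecidableEq I] {M : SimpleGraph I}

variable (M) in
/-- The right linear functionals on `V⁽⁰⁾`. -/
abbrev Functional : Type _ := V₀ M →ₗ[(Z₀ M)ᵐᵒᵖ] Z₀ M

theorem Functional.map_op_smul (φ : Functional M) (a : Z₀ M) (v : V₀ M) :
    φ (op a • v) = φ v * a := by
  rw [map_smul, op_smul_eq_mul]

variable (M) in
/-- The functional `φ ∘ (τ_i + m)`. -/
def step (i : I) (φ : Functional M) : Functional M := φ ∘ₗ tau M i + mZ M • φ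

theorem step_apply (i : I) (φ : Functional M) (v : V₀ M) :
    step M i φ v = φ (tau M i v) + mZ M * φ v := rfl

variable [FiniteType M]

theorem tau_comm_apply {i j : I} (hn : ¬ M.Adj i j) (v : V₀ M) :
    tau M i (tau M j v) = tau M j (tau M i v) :=
  LinearMap.congr_fun (tau_comm hn) v

theorem tau_braid_apply {i j : I} (hn : M.Adj i j) (v : V₀ M) :
    tau M i (tau M j (tau M i v)) = tau M j (tau M i (tau M j v)) :=
  LinearMap.congr_fun (tau_braid hn) v

theorem step_comm {i j : I} (hn : ¬ M.Adj i j) (φ : Functional M) :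
    step M i (step M j φ) = step M j (step M i φ) := by
  refine LinearMap.ext fun v => ?_
  simp only [step_apply, tau_comm_apply hn, mul_add]
  abel

open Classical in
variable (M) in
/-- The functional `φ_β`, defined along a shortest word for `β` from the coordinate function of
the highest root. -/
def phi (β : PosRoot M) : Functional M :=
  β.exists_isShortestWord.choose.foldr (step M) (Finsupp.lapply (top M))

theorem phi_eq_foldr {ω : List I} {β : PosRoot M} (hω : IsShortestWord M ω β.1) :
    phi M β = ω.foldr (step M) (Finsupp.lapply (top M)) :=
  foldr_eq_of_isShortestWord _ _ (fun _ _ hn φ => step_comm hn φ) _ _ _ β rfl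
    β.exists_isShortestWord.choose_spec hω

theorem phi_top (v : V₀ M) : phi M (top M) v = v (top M) := by
  rw [phi_eq_foldr isShortestWord_top]; rfl

theorem phi_add {β γ : PosRoot M} {i : I} (hi : form M (simple i) β.1 = -1)
    (hγ : γ.1 = β.1 + simple i) : phi M β = step M i (phi M γ) := by
  obtain ⟨ω, hω⟩ := γ.exists_isShortestWord
  rw [phi_eq_foldr hω, phi_eq_foldr (hω.cons hi hγ)]
  rfl

open Classical in
/-- The functionals `φ_β` are unitriangular with respect to the height. -/
theorem phi_xv : ∀ β γ : PosRoot M, ht γ.1 ≤ ht β.1 →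
    phi M β (xv M γ) = if γ = β then 1 else 0 :=
  PosRoot.induction_down fun β ih γ hle => by
    by_cases hβ : β = top M
    · subst hβ
      rw [phi_top, xv, Finsupp.single_apply]
    obtain ⟨k, hk⟩ := PosRoot.exists_form_eq_neg_one hβ
    obtain ⟨β', hβ'⟩ := PosRoot.exists_add hk
    have hht : ht β'.1 = ht β.1 + 1 := by rw [hβ', map_add, ht_simple]
    have ih' : ∀ δ : PosRoot M, ht δ.1 < ht β'.1 → phi M β' (xv M δ) = 0 := fun δ hδ => by
      rw [ih β' (by omega) δ hδ.le, if_neg]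
      rintro rfl
      omega
    rw [phi_add hk hβ', step_apply, ih' γ (by omega), mul_zero, add_zero]
    rcases γ.form_cases k with h | h | h | h
    · rw [h, tau_self, map_zero, if_neg]
      rintro rfl
      have := form_self M k
      change form M (simple k) (simple k) = -1 at hk
      omega
    · obtain ⟨δ, hδ⟩ := PosRoot.exists_sub h
      have : ht δ.1 = ht γ.1 - 1 := by rw [hδ, map_sub, ht_simple]
      rw [tau_sub h hδ, ih' δ (by omega), if_neg]
      rintro rfl
      omega
    · rw [tau_zero h, Functional.map_op_smul, ih' γ (by omega), zero_mul, if_neg]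
      rintro rfl
      omega
    · obtain ⟨δ, hδ⟩ := PosRoot.exists_add h
      have : ht δ.1 = ht γ.1 + 1 := by rw [hδ, map_add, ht_simple]
      rw [tau_add h hδ, map_sub, Functional.map_op_smul, ih' γ (by omega), zero_mul, sub_zero,
        ih β' (by omega) δ (by omega)]
      have : δ = β' ↔ γ = β := by
        rw [Subtype.ext_iff, Subtype.ext_iff, hδ, hβ', add_left_inj]
      simp only [this]

theorem phi_xv_simpleRoot {β : PosRoot M} {i : I} (hβ : simpleRoot M i ≠ β) :
    phi M β (xv M (simpleRoot M i)) = 0 := by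
  classical
  rw [phi_xv, if_neg hβ]
  have := β.ht_pos
  change ht (simple i) ≤ _
  rw [ht_simple]
  omega

/-- The quadratic relation for the adjoint of `τ_i` on functionals that vanish on `x_{α_i}`. -/
theorem Functional.apply_tau_tau {φ : Functional M} {i : I}
    (hφ : φ (xv M (simpleRoot M i)) = 0) (v : V₀ M) :
    φ (tau M i (tau M i v)) = φ v - mZ M * φ (tau M i v) := by
  have : φ ∘ₗ tau M i ∘ₗ tau M i = φ - mZ M • (φ ∘ₗ tau M i) := by
    refine ext_xv fun β => ?_
    simp only [LinearMap.comp_apply, LinearMap.sub_apply, LinearMap.smul_apply, smul_eq_mul]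
    by_cases hβ : β = simpleRoot M i
    · rw [hβ, tau_self, map_zero, map_zero, hφ, mul_zero, sub_zero]
    · rw [tau_tau_xv hβ, map_sub, Functional.map_op_smul, mZ_comm]
  exact LinearMap.congr_fun this v

/-- The functional φ_γ vanishes on x_{α_i}, so there τ_i + m inverts τ_i, and composing with τ_i
undoes the step from γ down to β. -/
theorem phi_tau_add {β γ : PosRoot M} {i : I} (hi : form M (simple i) β.1 = -1)
    (hγ : γ.1 = β.1 + simple i) (v : V₀ M) : phi M β (tau M i v) = phi M γ v := by
  rw [phi_add hi hγ, step_apply, Functional.apply_tau_tau, sub_add_cancel]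
  refine phi_xv_simpleRoot ?_
  rintro rfl
  have h1 := form_add_of_self hi hγ
  have h2 : form M (simple i) (simpleRoot M i).1 = 2 := form_self M i
  omega

/-- A root with nonzero product with α_i is not the highest root, and neither is any root occurring
in the image of its basis vector under τ_i, since that root again has nonzero product with α_i.
Hence only x_β with β the highest root contributes. -/
theorem phi_top_tau {i : I} (hi : form M (simple i) (top M).1 = 0) (v : V₀ M) :
    phi M (top M) (tau M i v) = h M (top M) i * phi M (top M) v := by
  have hz : ∀ γ : PosRoot M, form M (simple i) γ.1 ≠ 0 → phi M (top M) (xv M γ) = 0 := by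
    intro γ hγ
    rw [phi_top, xv, Finsupp.single_apply, if_neg]
    rintro rfl
    exact hγ hi
  have : phi M (top M) ∘ₗ tau M i = h M (top M) i • phi M (top M) := by
    refine ext_xv fun γ => ?_
    simp only [LinearMap.comp_apply, LinearMap.smul_apply, smul_eq_mul]
    rcases γ.form_cases i with h | h | h | h
    · rw [h, tau_self, map_zero, hz, mul_zero]
      have h1 : form M (simple i) (simpleRoot M i).1 = 2 := form_self M i
      omega
    · obtain ⟨δ, hδ⟩ := PosRoot.exists_sub h
      have := form_sub_of_self h hδ
      rw [tau_sub h hδ, hz γ (by omega), hz δ (by omega), mul_zero]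
    · rw [tau_zero h, Functional.map_op_smul]
      by_cases hγ : γ = top M
      · subst hγ
        rw [phi_top, xv, Finsupp.single_eq_same, one_mul, mul_one]
      · have : phi M (top M) (xv M γ) = 0 := by
          rw [phi_top, xv, Finsupp.single_apply, if_neg hγ]
        rw [this, zero_mul, mul_zero]
    · obtain ⟨δ, hδ⟩ := PosRoot.exists_add h
      have := form_add_of_self h hδ
      rw [tau_add h hδ, map_sub, Functional.map_op_smul, hz γ (by omega), hz δ (by omega),
        mul_zero, zero_mul, sub_zero]
  exact LinearMap.congr_fun this v

/-- Descend from the highest root. A nonadjacent step commutes with τ_j. For an adjacent step, φ_β =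
φ_δ (τ_j + m)(τ_k + m) with δ = β + α_k + α_j, and the braid relation gives φ_δ (τ_j + m)(τ_k + m)
τ_j = φ_δ τ_k (τ_j + m)(τ_k + m), as if τ + m were the inverse of τ. The quadratic relations, for
φ_δ and for h_{δ,k}, make this precise. -/
theorem phi_tau_zero : ∀ (β : PosRoot M) (j : I), form M (simple j) β.1 = 0 → ∀ v : V₀ M,
    phi M β (tau M j v) = h M β j * phi M β v :=
  PosRoot.induction_down fun β ih j hj v => by
    by_cases hβ : β = top M
    · subst hβ; exact phi_top_tau hj v
    obtain ⟨k, hk⟩ := PosRoot.exists_form_eq_neg_one hβ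
    obtain ⟨γ, hγ⟩ := PosRoot.exists_add hk
    have hht : ht γ.1 = ht β.1 + 1 := by rw [hγ, map_add, ht_simple]
    by_cases hjk : M.Adj j k
    · have h1 := form_add_of_adj hjk hj hγ
      obtain ⟨δ, hδ⟩ := PosRoot.exists_add (β := γ) (i := j) (by omega)
      have hht' : ht δ.1 = ht γ.1 + 1 := by rw [hδ, map_add, ht_simple]
      have hkγ := form_add_of_self hk hγ
      have h2 : form M (simple k) δ.1 = 0 := form_add_of_adj hjk.symm hkγ hδ
      have h3 : form M (simple j) δ.1 = 1 := form_add_of_self h1 hδ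
      have hs : ∀ i, simpleRoot M i ≠ δ := by
        rintro i rfl
        have h4 : ht (simpleRoot M i).1 = 1 := ht_simple i
        have := β.ht_pos
        omega
      rw [phi_add hk hγ, phi_add (by omega) hδ,
        h_sub_sub h3 h2 hjk (by rw [hδ, hγ]; abel)]
      have ihk := ih δ (by omega) k h2
      simp only [step_apply, tau_braid_apply hjk, Functional.apply_tau_tau (phi_xv_simpleRoot (hs j)),
        ihk, mul_add, mul_sub, ← mul_assoc, ← mZ_comm]
      have h4 : h M δ k * h M δ k * phi M δ v = phi M δ v - mZ M * h M δ k * phi M δ v := by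
        rw [h_quad h2, sub_mul, one_mul]
      have h5 : mZ M * h M δ k * h M δ k * phi M δ v =
          mZ M * phi M δ v - mZ M * mZ M * h M δ k * phi M δ v := by
        rw [mul_assoc (mZ M), mul_assoc (mZ M), h4, mul_sub]
        simp only [mul_assoc]
      rw [h5]
      abel
    · have hjk' : j ≠ k := by rintro rfl; omega
      have h1 := form_add_of_not_adj hjk' hjk hj hγ
      have ih' := ih γ (by omega) j h1
      have hkj : ¬ M.Adj k j := fun h => hjk h.symm
      rw [phi_add hk hγ, h_add hk hγ hjk, step_apply, step_apply, tau_comm_apply hkj, ih', ih',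
        mul_add, ← mul_assoc, ← mul_assoc, mZ_comm]

/-- The conditions on functionals `φ_i` that are equivalent to the braid relations for the maps
`v ↦ τ_i v + l⁻¹ x_{α_i} φ_i v`. -/
structure IsCompatible (φ : I → Functional M) : Prop where
  diag : ∀ i, φ i (xv M (simpleRoot M i)) = 1
  off_diag : ∀ i j, i ≠ j → φ i (xv M (simpleRoot M j)) = 0
  comm : ∀ i j, i ≠ j → ¬ M.Adj i j → ∀ v, φ i (tau M j v) = h M (simpleRoot M i) j * φ i v
  adj : ∀ i j, M.Adj i j → ∀ v, φ i (tau M j v) = φ j (tau M i v)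

/-- For adjacent i and j both sides of the last condition are the functional of the root α_i + α_j.
-/
theorem isCompatible_phi : IsCompatible fun i => phi M (simpleRoot M i) where
  diag i := by
    classical
    rw [phi_xv _ _ le_rfl, if_pos rfl]
  off_diag i j hij := phi_xv_simpleRoot fun h => hij <| by
    by_contra hn
    have := congrFun (congrArg Subtype.val h) j
    simp [simpleRoot, simple, Ne.symm hij] at this
  comm i j hij hn v := phi_tau_zero _ _ (form_not_adj M hij.symm fun h => hn h.symm) v
  adj i j hij v := by
    have hj : form M (simple j) (simpleRoot M i).1 = -1 := form_adj M hij.symm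
    have hi : form M (simple i) (simpleRoot M j).1 = -1 := form_adj M hij
    obtain ⟨γ, hγ⟩ := PosRoot.exists_add hj
    rw [phi_tau_add hj hγ, phi_tau_add hi (γ := γ)]
    rw [hγ]
    exact add_comm _ _

theorem simpleRoot_injective : Function.Injective (simpleRoot M) := by
  intro i j h
  by_contra hij
  have := congrFun (congrArg Subtype.val h) i
  simp [simpleRoot, simple, hij] at this

/-- Each equation is one compatibility condition evaluated at x_{α_i}, x_β or x_{β-α_j}, solved for
T_{i,β}. -/
theorem IsCompatible.tEquations {φ : I → Functional M} (hφ : IsCompatible φ) :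
    TEquations M fun i β => φ i (xv M β) where
  off_diag := hφ.off_diag
  diag := hφ.diag
  height_two i j β hβ := by
    have h1 := β.form_self
    rw [hβ] at h1
    simp only [form_add_left, form_add_right, form_self, form_comm M (simple j)] at h1
    have hij := adj_of_form M (show form M (simple i) (simple j) = -1 by omega)
    have hj : form M (simple j) (simpleRoot M i).1 = -1 := form_adj M hij.symm
    have h2 := hφ.adj i j hij (xv M (simpleRoot M i))
    rw [tau_self, map_zero, tau_add hj hβ, map_sub, Functional.map_op_smul, hφ.diag, one_mul] at h2
    exact sub_eq_zero.1 h2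
  comm i j β β' hj hij hβ' := by
    have h1 := hφ.comm i j (ne_of_form M hij) (not_adj_of_form M hij) (xv M β)
    rw [tau_sub hj hβ'] at h1
    rw [h1, ← mul_assoc, hInv_mul_h (by rw [form_comm]; exact hij), one_mul]
  zero_one i j β β' β'' hi hj hij hβ' hβ'' := by
    have hadj := adj_of_form M hij
    have h1 := hφ.adj i j hadj (xv M β')
    have hi' := form_sub_of_adj hadj hi hβ'
    have hj' := form_sub_of_self hj hβ'
    rw [tau_add hj' (γ := β) (by rw [hβ']; abel), tau_sub hi' (γ := β'') (by rw [hβ'', hβ']; abel),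
      map_sub, Functional.map_op_smul, ← mZ_comm, sub_eq_iff_eq_add] at h1
    exact h1
  neg_one i j β β' hi hj hij hβ' := by
    have hadj := adj_of_form M hij
    have h1 := hφ.adj i j hadj (xv M β')
    have hi' := form_sub_of_adj hadj hi hβ'
    have hj' := form_sub_of_self hj hβ'
    rw [tau_add hj' (γ := β) (by rw [hβ']; abel), tau_zero hi', Functional.map_op_smul,
      map_sub, Functional.map_op_smul, ← mZ_comm, sub_eq_iff_eq_add] at h1
    exact h1
  one_zero i j β β' hi hj hij hβ' := by
    have h1 := hφ.adj i j (adj_of_form M hij) (xv M β)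
    rw [tau_zero hj, tau_sub hi hβ', Functional.map_op_smul] at h1
    rw [← h1, mul_assoc, h_mul_hInv hj, mul_one]

/-- Induction on the height: for every β that is not simple, some equation expresses T_{i,β} by m or
by values at lower roots. Membership in Z₀⁽¹⁾ plays no role. -/
theorem TEquations.unique {T T' : I → PosRoot M → Z₀ M} (hT : TEquations M T)
    (hT' : TEquations M T') : T = T' := by
  have key : ∀ β i, T i β = T' i β := by
    refine PosRoot.induction_up fun β ih i => ?_
    by_cases hs : ∃ k, β = simpleRoot M k
    · obtain ⟨k, rfl⟩ := hs
      by_cases hik : i = k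
      · rw [hik, hT.diag, hT'.diag]
      · rw [hT.off_diag i k hik, hT'.off_diag i k hik]
    push Not at hs
    by_cases hex : ∃ j, j ≠ i ∧ form M (simple j) β.1 = 1
    · obtain ⟨j, hji, hj⟩ := hex
      obtain ⟨β', hβ'⟩ := PosRoot.exists_sub hj
      have hht : ht β'.1 = ht β.1 - 1 := by rw [hβ', map_sub, ht_simple]
      by_cases hij : M.Adj i j
      · have hf := form_adj M hij
        rcases β.form_cases i with hi | hi | hi | hi
        · exact absurd hi (hs i)
        · have h1 := PosRoot.eq_simpleRoot (form_sub_of_adj hij hi hβ')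
          have hβ : β.1 = simple i + simple j := by
            have h2 : β'.1 = simple i := by rw [h1]; rfl
            rw [← h2, hβ']; abel
          rw [hT.height_two i j β hβ, hT'.height_two i j β hβ]
        · have hi' := form_sub_of_adj hij hi hβ'
          obtain ⟨β'', hβ''⟩ := PosRoot.exists_sub hi'
          have hht' : ht β''.1 = ht β'.1 - 1 := by rw [hβ'', map_sub, ht_simple]
          have h3 : β''.1 = β.1 - simple i - simple j := by rw [hβ'', hβ']; abel
          rw [hT.zero_one i j β β' β'' hi hj hf hβ' h3, hT'.zero_one i j β β' β'' hi hj hf hβ' h3,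
            ih β' (by omega), ih β'' (by omega)]
        · rw [hT.neg_one i j β β' hi hj hf hβ', hT'.neg_one i j β β' hi hj hf hβ',
            ih β' (by omega), ih β' (by omega)]
      · have hf := form_not_adj M (Ne.symm hji) hij
        rw [hT.comm i j β β' hj hf hβ', hT'.comm i j β β' hj hf hβ', ih β' (by omega)]
    -- Now α_i is the only simple root with product 1 with β. If β - α_i is not simple, some α_j has
    -- product 1 with it; j must be adjacent to i, as otherwise (α_j, β) = 1. Hence (α_j, β) = 0 and
    -- the last equation applies.
    · push Not at hex
      obtain ⟨k, hk⟩ := β.exists_form_eq_one hs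
      obtain rfl : k = i := by_contra fun hki => hex k hki hk
      obtain ⟨γ, hγ⟩ := PosRoot.exists_sub hk
      have hht : ht γ.1 = ht β.1 - 1 := by rw [hγ, map_sub, ht_simple]
      by_cases hsγ : ∃ j, γ = simpleRoot M j
      · obtain ⟨j, rfl⟩ := hsγ
        have hβ : β.1 = simple k + simple j := by
          change simple j = _ at hγ
          rw [hγ]; abel
        rw [hT.height_two k j β hβ, hT'.height_two k j β hβ]
      · push Not at hsγ
        obtain ⟨j, hj⟩ := γ.exists_form_eq_one hsγ
        have hβγ : β.1 = γ.1 + simple k := by rw [hγ]; abel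
        have hjk : j ≠ k := by
          rintro rfl
          have := form_add_of_self hj hβγ
          omega
        by_cases hadj : M.Adj j k
        · have hj' := form_add_of_adj hadj hj hβγ
          have hf := form_adj M hadj.symm
          rw [hT.one_zero k j β γ hk hj' hf hγ, hT'.one_zero k j β γ hk hj' hf hγ, ih γ (by omega)]
        · exact absurd (form_add_of_not_adj hjk hadj hj hβγ) (hex j hjk)
  ext i β
  exact key β i

end Functionals

/-! ### The subalgebra `Z₀⁽¹⁾` -/

section Subalgebra

variable {I : Type*} [Fintype I] [DecidableEq I] {M : SimpleGraph I}

theorem mZ_mem : mZ M ∈ Z₁ M := Algebra.subset_adjoin (Set.mem_insert _ _)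

theorem h_mem (β : PosRoot M) (i : I) : h M β i ∈ Z₁ M := by
  rw [h]
  split_ifs
  · exact Algebra.subset_adjoin (Set.mem_insert_of_mem _ ⟨_, rfl⟩)
  · exact zero_mem _

variable [FiniteType M]

theorem Functional.apply_tau_mem {φ : Functional M} (hφ : ∀ β, φ (xv M β) ∈ Z₁ M) (i : I)
    (β : PosRoot M) : φ (tau M i (xv M β)) ∈ Z₁ M := by
  rcases β.form_cases i with h | h | h | h
  · rw [h, tau_self, map_zero]
    exact zero_mem _
  · obtain ⟨δ, hδ⟩ := PosRoot.exists_sub h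
    rw [tau_sub h hδ]
    exact hφ δ
  · rw [tau_zero h, Functional.map_op_smul]
    exact mul_mem (hφ β) (h_mem β i)
  · obtain ⟨δ, hδ⟩ := PosRoot.exists_add h
    rw [tau_add h hδ, map_sub, Functional.map_op_smul]
    exact sub_mem (hφ δ) (mul_mem (hφ β) mZ_mem)

/-- The construction of φ_β involves only the τ_i and m, hence no power of l. -/
theorem phi_xv_mem : ∀ β γ : PosRoot M, phi M β (xv M γ) ∈ Z₁ M :=
  PosRoot.induction_down fun β ih γ => by
    by_cases hβ : β = top M
    · subst hβ
      classical
      rw [phi_top, xv, Finsupp.single_apply]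
      split_ifs
      · exact one_mem _
      · exact zero_mem _
    · obtain ⟨k, hk⟩ := PosRoot.exists_form_eq_neg_one hβ
      obtain ⟨β', hβ'⟩ := PosRoot.exists_add hk
      have hht : ht β'.1 = ht β.1 + 1 := by rw [hβ', map_add, ht_simple]
      rw [phi_add hk hβ', step_apply]
      exact add_mem (Functional.apply_tau_mem (ih β' (by omega)) k γ)
        (mul_mem mZ_mem (ih β' (by omega) γ))

end Subalgebra

/-! ### Scaling the indeterminate `l` -/

section Scaling

theorem algebraicIndependent_l_x : AlgebraicIndependent ℚ ![l, x] := by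
  have h1 : AlgebraicIndependent ℚ (MvPolynomial.X : Fin 2 → MvPolynomial (Fin 2) ℚ) :=
    MvPolynomial.algebraicIndependent_X _ _
  have h2 := h1.map' (f := Algebra.algHom ℚ (MvPolynomial (Fin 2) ℚ) K)
    (FaithfulSMul.algebraMap_injective (MvPolynomial (Fin 2) ℚ) K)
  convert h2 using 1
  ext i
  fin_cases i <;> rfl

theorem transcendental_l : Transcendental ℚ l := algebraicIndependent_l_x.transcendental 0

theorem transcendental_x : Transcendental ℚ x := algebraicIndependent_l_x.transcendental 1

theorem ne_zero_of_transcendental {a : K} (h : Transcendental ℚ a) : a ≠ 0 := by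
  rintro rfl
  exact h isAlgebraic_zero

theorem l_ne_zero : l ≠ 0 := ne_zero_of_transcendental transcendental_l

theorem one_sub_x_ne_zero : 1 - x ≠ 0 := fun h =>
  transcendental_x (by rw [← sub_eq_zero.1 h]; exact isAlgebraic_one)

theorem l_sq_ne {a : K} (ha : IsAlgebraic ℚ a) : l ^ 2 ≠ a := fun h =>
  transcendental_l (IsAlgebraic.of_pow two_pos (h ▸ ha))

theorem l_sub_inv_ne_zero : l - l⁻¹ ≠ 0 := fun h => by
  have h1 := l_ne_zero
  refine l_sq_ne isAlgebraic_one ?_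
  have h2 : l * (l - l⁻¹) = 0 := by rw [h, mul_zero]
  rw [mul_sub, mul_inv_cancel₀ h1] at h2
  linear_combination h2

theorem half_l_sub_inv_ne_zero : l / 2 - (l / 2)⁻¹ ≠ 0 := fun h => by
  have h1 := l_ne_zero
  have h0 : l / 2 ≠ 0 := div_ne_zero h1 two_ne_zero
  refine l_sq_ne (isAlgebraic_algebraMap (R := ℚ) 4) ?_
  have h2 : l / 2 * (l / 2 - (l / 2)⁻¹) = 0 := by rw [h, mul_zero]
  rw [mul_sub, mul_inv_cancel₀ h0] at h2
  rw [map_ofNat]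
  linear_combination 4 * h2

theorem m_ne_zero : m ≠ 0 := div_ne_zero l_sub_inv_ne_zero one_sub_x_ne_zero

/-- The image of `x` under the endomorphism of `ℚ(l, x)` that halves `l` and fixes `m`. -/
def scaledX : K := 1 - (l / 2 - (l / 2)⁻¹) / m

theorem x_eq_of_scaledX :
    x = 1 - (1 - scaledX) * ((l - l⁻¹) / (l / 2 - (l / 2)⁻¹)) := by
  have h1 := l_sub_inv_ne_zero
  have h2 := half_l_sub_inv_ne_zero
  have h3 := one_sub_x_ne_zero
  rw [scaledX, m]
  generalize l - l⁻¹ = a at *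
  generalize l / 2 - (l / 2)⁻¹ = b at *
  field_simp
  ring

/-- By `x_eq_of_scaledX`, x is a rational expression in l and `scaledX`. If `scaledX` were algebraic
over ℚ[l/2], x would be algebraic over ℚ[l]. -/
theorem algebraicIndependent_scaled : AlgebraicIndependent ℚ ![l / 2, scaledX] := by
  rw [AlgebraicIndependent.iff_transcendental_adjoin_image (1 : Fin 2)]
  have hset : ∀ a b : K, ![a, b] '' {1}ᶜ = {a} := by
    intro a b
    have : ({1}ᶜ : Set (Fin 2)) = {0} := by ext i; fin_cases i <;> simp
    rw [this]; simp
  have hhalf : l = l / 2 + l / 2 := by ring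
  constructor
  · let _ : Unique {j : Fin 2 // j ≠ 1} := ⟨⟨⟨0, by decide⟩⟩, by decide⟩
    rw [algebraicIndependent_unique_type_iff]
    change ¬ IsAlgebraic ℚ (l / 2)
    intro h
    refine transcendental_l ?_
    rw [hhalf]
    exact h.add h
  · rw [hset]
    intro h
    have h1 := algebraicIndependent_l_x.transcendental_adjoin (s := {1}ᶜ) (i := 1) (by simp)
    rw [hset] at h1
    refine h1 ?_
    change IsAlgebraic (Algebra.adjoin ℚ {l}) x
    have hle : Algebra.adjoin ℚ {l / 2} ≤ Algebra.adjoin ℚ {l} := by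
      refine Algebra.adjoin_le ?_
      rintro _ rfl
      have h2 : l / 2 = algebraMap ℚ K 2⁻¹ * l := by
        rw [map_inv₀, map_ofNat, div_eq_inv_mul]
      rw [h2]
      exact mul_mem (Subalgebra.algebraMap_mem _ _) (Algebra.self_mem_adjoin_singleton ℚ l)
    have hs : IsAlgebraic (Algebra.adjoin ℚ {l}) scaledX :=
      h.tower_top_of_subalgebra_le hle
    have hA : IsAlgebraic (Algebra.adjoin ℚ {l}) l :=
      isAlgebraic_algebraMap (⟨l, Algebra.self_mem_adjoin_singleton ℚ l⟩ : Algebra.adjoin ℚ {l})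
    have h2 : IsAlgebraic (Algebra.adjoin ℚ {l}) (l / 2) := by
      rw [div_eq_mul_inv]
      have h3 : IsAlgebraic (Algebra.adjoin ℚ {l}) (2 : K) := by
        have := isAlgebraic_algebraMap (A := K) (2 : Algebra.adjoin ℚ {l})
        rwa [map_ofNat] at this
      exact hA.mul h3.inv
    rw [x_eq_of_scaledX, div_eq_mul_inv]
    exact isAlgebraic_one.sub ((isAlgebraic_one.sub hs).mul
      ((hA.sub hA.inv).mul (h2.sub h2.inv).inv))

/-- Algebraic independence lets the substitution extend to the field of fractions, and `scaledX` is
the value of x for which halving l leaves m unchanged. -/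
theorem exists_scaling_field : ∃ Ψ : K →ₐ[ℚ] K, Ψ l = l / 2 ∧ Ψ m = m := by
  let Ψ : K →ₐ[ℚ] K := IsFractionRing.liftAlgHom (K := K)
    (g := MvPolynomial.aeval (R := ℚ) ![l / 2, scaledX]) algebraicIndependent_scaled
  have hΨ : ∀ p : MvPolynomial (Fin 2) ℚ, Ψ (algebraMap _ K p) =
      MvPolynomial.aeval (R := ℚ) ![l / 2, scaledX] p := fun p =>
    IsFractionRing.lift_algebraMap algebraicIndependent_scaled p
  have hl : Ψ l = l / 2 := by
    refine (hΨ _).trans ?_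
    rw [MvPolynomial.aeval_X]; rfl
  have hx : Ψ x = scaledX := by
    refine (hΨ _).trans ?_
    rw [MvPolynomial.aeval_X]; rfl
  refine ⟨Ψ, hl, ?_⟩
  have h2 := half_l_sub_inv_ne_zero
  conv_lhs => rw [m]
  rw [map_div₀, map_sub, map_sub, map_inv₀, hl, hx, map_one, scaledX, sub_sub_cancel,
    div_div_cancel₀ h2]

theorem exists_scaling_R₀ : ∃ ψ : R₀ →ₐ[ℚ] R₀, ψ linv₀ = 2 * linv₀ ∧ ψ m₀ = m₀ := by
  obtain ⟨Ψ, hl, hm⟩ := exists_scaling_field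
  have hinv : Ψ l⁻¹ = 2 * l⁻¹ := by
    rw [map_inv₀, hl, inv_div, div_eq_mul_inv]
  have hmem : ∀ r : R₀, (Ψ.comp R₀.val) r ∈ R₀ := by
    rintro ⟨r, hr⟩
    have hle : R₀ ≤ R₀.comap Ψ := by
      refine Algebra.adjoin_le ?_
      rintro _ (rfl | rfl | rfl)
      · change Ψ l ∈ R₀
        have h2 : l / 2 = algebraMap ℚ K 2⁻¹ * l := by
          rw [map_inv₀, map_ofNat, div_eq_inv_mul]
        rw [hl, h2]
        exact mul_mem (Subalgebra.algebraMap_mem _ _) (Algebra.subset_adjoin (by simp))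
      · change Ψ l⁻¹ ∈ R₀
        rw [hinv]
        exact mul_mem (ofNat_mem _ 2) linv₀.2
      · change Ψ m ∈ R₀
        rw [hm]
        exact m₀.2
    exact hle hr
  exact ⟨(Ψ.comp R₀.val).codRestrict R₀ hmem, Subtype.ext hinv, Subtype.ext hm⟩

variable {I : Type*} [Fintype I] [DecidableEq I] {M : SimpleGraph I} [FiniteType M]

/-- The universal property of the Hecke algebra. -/
theorem exists_hecke_hom {S : Type*} [Ring S] (ψ : R₀ →+* S) (hψ : ∀ r a, ψ r * a = a * ψ r)
    (ζ : C M → S) (hc : ∀ i j : C M, ¬ M.Adj i j → ζ i * ζ j = ζ j * ζ i)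
    (hb : ∀ i j : C M, M.Adj i j → ζ i * ζ j * ζ i = ζ j * ζ i * ζ j)
    (hq : ∀ i, ζ i * ζ i + ψ m₀ * ζ i - 1 = 0) :
    ∃ f : Z₀ M →+* S, (∀ r, f (algebraMap R₀ (Z₀ M) r) = ψ r) ∧ ∀ j, f (z M j) = ζ j := by
  let _ : Algebra R₀ S := ψ.toAlgebra' hψ
  have H : ∀ ⦃a b⦄, HeckeRel (M.induce (C M)) m₀ a b →
      FreeAlgebra.lift R₀ ζ a = FreeAlgebra.lift R₀ ζ b := by
    rintro _ _ (⟨i, j, h⟩ | ⟨i, j, h⟩ | ⟨i⟩)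
    · simpa only [map_mul, FreeAlgebra.lift_ι_apply] using hc i j h
    · simpa only [map_mul, FreeAlgebra.lift_ι_apply] using hb i j h
    · simp only [map_sub, map_add, map_mul, map_smul, map_one, map_zero, FreeAlgebra.lift_ι_apply]
      rw [Algebra.smul_def]
      exact hq i
  refine ⟨(RingQuot.liftAlgHom R₀ ⟨FreeAlgebra.lift R₀ ζ, H⟩ : _ →ₐ[R₀] S).toRingHom,
    fun r => AlgHom.commutes (RingQuot.liftAlgHom R₀ ⟨FreeAlgebra.lift R₀ ζ, H⟩) r, fun j => ?_⟩
  refine (RingQuot.liftAlgHom_mkAlgHom_apply _ _ H _).trans ?_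
  rw [FreeAlgebra.lift_ι_apply]

/-- The defining relations of the Hecke algebra involve only m, so the scaling extends by fixing
every z_j. It grades by powers of l without requiring a basis of the Hecke algebra. -/
theorem exists_scaling_Z₀ : ∃ θ : Z₀ M →+* Z₀ M, (∀ a ∈ Z₁ M, θ a = a) ∧
    θ (algebraMap R₀ (Z₀ M) linv₀) = 2 * algebraMap R₀ (Z₀ M) linv₀ := by
  obtain ⟨ψ, hl, hm⟩ := exists_scaling_R₀
  obtain ⟨f, hf', hf⟩ := exists_hecke_hom ((algebraMap R₀ (Z₀ M)).comp ψ.toRingHom)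
    (fun c a => Algebra.commutes (R := R₀) (ψ c) a)
    (z M) (fun i j h => z_comm h) (fun i j h => z_braid h) (fun i => by
      change z M i * z M i + algebraMap R₀ (Z₀ M) (ψ m₀) * z M i - 1 = 0
      rw [hm, z_quad]; abel)
  replace hf' : ∀ r, f (algebraMap R₀ (Z₀ M) r) = algebraMap R₀ (Z₀ M) (ψ r) := hf'
  refine ⟨f, fun a ha => ?_, ?_⟩
  · induction ha using Algebra.adjoin_induction with
    | mem a ha =>
      rcases ha with rfl | ⟨j, rfl⟩
      · rw [hf', hm]
      · exact hf j
    | algebraMap q => exact RingHom.map_rat_algebraMap _ q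
    | add a b _ _ ha hb => rw [map_add, ha, hb]
    | mul a b _ _ ha hb => rw [map_mul, ha, hb]
  · rw [hf', hl, map_mul, map_ofNat]

/-- `l` as an element of `ℚ[l, l⁻¹, m]`. -/
def l₀ : R₀ := ⟨l, Algebra.subset_adjoin (by simp)⟩

theorem l₀_mul_linv₀ : l₀ * linv₀ = 1 := Subtype.ext (mul_inv_cancel₀ l_ne_zero)

/-- The powers of `l` are linearly independent over `Z₀⁽¹⁾`. -/
theorem eq_zero_of_linv₀_smul {a b c : Z₀ M} (ha : a ∈ Z₁ M) (hb : b ∈ Z₁ M) (hc : c ∈ Z₁ M)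
    (H : linv₀ • a + linv₀ ^ 2 • b + linv₀ ^ 3 • c = 0) : a = 0 ∧ b = 0 := by
  obtain ⟨θ, hθ, hl⟩ := exists_scaling_Z₀ (M := M)
  have key : ∀ (n : ℕ) (a : Z₀ M), linv₀ ^ n • a = 0 → a = 0 := by
    intro n a h
    have := congrArg (l₀ ^ n • ·) h
    simpa only [smul_smul, ← mul_pow, l₀_mul_linv₀, one_pow, one_smul, smul_zero] using this
  have hθ' : ∀ (n : ℕ) (a : Z₀ M), a ∈ Z₁ M →
      θ (linv₀ ^ n • a) = ((2 : ℚ) ^ n) • (linv₀ ^ n • a) := by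
    intro n a h
    rw [Algebra.smul_def, map_mul, hθ a h, map_pow, map_pow, hl, Algebra.smul_def, map_pow,
      map_ofNat, (Commute.ofNat_left 2 _).mul_pow, mul_assoc]
  have hθq : ∀ (q : ℚ) (a : Z₀ M), θ (q • a) = q • θ a := fun q a => map_rat_smul θ q a
  rw [← pow_one linv₀, ← pow_mul, ← pow_mul] at H
  have H1 := congrArg θ H
  simp only [map_add, map_zero, hθ' _ _ ha, hθ' _ _ hb, hθ' _ _ hc] at H1
  have H2 := congrArg θ H1
  simp only [map_add, map_zero, hθq, hθ' _ _ ha, hθ' _ _ hb, hθ' _ _ hc] at H2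
  norm_num only [smul_smul] at H H1 H2
  have ka := key 1 a
  have kb := key 2 b
  generalize linv₀ ^ 1 • a = a' at *
  generalize linv₀ ^ 2 • b = b' at *
  generalize linv₀ ^ 3 • c = c' at *
  constructor
  · apply ka
    -- On the three terms the scaling has eigenvalues 2, 4, 8. The coefficients come from (t - 4)(t
    -- - 8), with value 12 at 2; those for `b'` come from (t - 2)(t - 8), with value -8 at 4.
    calc a' = (1 / 12 : ℚ) • ((32 : ℚ) • (a' + b' + c') -
          (12 : ℚ) • ((2 : ℚ) • a' + (4 : ℚ) • b' + (8 : ℚ) • c') +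
          ((4 : ℚ) • a' + (16 : ℚ) • b' + (64 : ℚ) • c')) := by module
      _ = 0 := by rw [H, H1, H2]; simp
  · apply kb
    calc b' = (-1 / 8 : ℚ) • ((16 : ℚ) • (a' + b' + c') -
          (10 : ℚ) • ((2 : ℚ) • a' + (4 : ℚ) • b' + (8 : ℚ) • c') +
          ((4 : ℚ) • a' + (16 : ℚ) • b' + (64 : ℚ) • c')) := by module
      _ = 0 := by rw [H, H1, H2]; simp

end Scaling

set_option linter.unusedSimpArgs false

/-! ### The maps `σ_i` -/

section Sigma

variable {I : Type*} [Fintype I] [DecidableEq I] {M : SimpleGraph I}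

variable (M) in
/-- The coordinate function of a positive root. -/
def coord (γ : PosRoot M) : Functional M := Finsupp.lapply γ

theorem coord_xv_self (γ : PosRoot M) : coord M γ (xv M γ) = 1 := by
  simp [coord, xv]

theorem coord_xv_ne {β γ : PosRoot M} (hne : β ≠ γ) : coord M γ (xv M β) = 0 := by
  simp [coord, xv, hne]

theorem TEnd_apply {T : I → PosRoot M → Z₀ M} {φ : I → Functional M}
    (hφ : ∀ i β, φ i (xv M β) = T i β) (i : I) (v : V₀ M) :
    TEnd M T i v = op (φ i v) • xv M (simpleRoot M i) := by
  let f : V₀ M →ₗ[(Z₀ M)ᵐᵒᵖ] V₀ M :=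
    { toFun := fun v => op (φ i v) • xv M (simpleRoot M i)
      map_add' := fun u v => by rw [map_add, op_add, add_smul]
      map_smul' := fun a v => by
        rw [map_smul, RingHom.id_apply, smul_smul]; rfl }
  have : TEnd M T i = f := ext_xv fun β => by
    rw [TEnd, ofBasis_xv]
    change _ = op (φ i (xv M β)) • xv M (simpleRoot M i)
    rw [hφ]
  rw [this]
  rfl

theorem exists_functional (T : I → PosRoot M → Z₀ M) :
    ∃ φ : I → Functional M, ∀ i β, φ i (xv M β) = T i β :=
  ⟨fun i => coord M (simpleRoot M i) ∘ₗ TEnd M T i, fun i β => by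
    rw [LinearMap.comp_apply, TEnd, ofBasis_xv, Functional.map_op_smul, coord_xv_self, one_mul]⟩

variable (M) in
/-- The map `σ_i = τ_i + l⁻¹ T_i`. -/
def sigma (T : I → PosRoot M → Z₀ M) (i : I) : Module.End (Z₀ M)ᵐᵒᵖ (V₀ M) :=
  tau M i + linv₀ • TEnd M T i

theorem sigma_apply {T : I → PosRoot M → Z₀ M} {φ : I → Functional M}
    (hφ : ∀ i β, φ i (xv M β) = T i β) (i : I) (v : V₀ M) :
    sigma M T i v = tau M i v + linv₀ • op (φ i v) • xv M (simpleRoot M i) := by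
  rw [sigma, LinearMap.add_apply, LinearMap.smul_apply, TEnd_apply hφ]

variable [FiniteType M]

theorem exists_add_simpleRoot {i j : I} (hij : M.Adj i j) : ∃ γ : PosRoot M,
    γ.1 = simple i + simple j :=
  PosRoot.exists_add (β := simpleRoot M i) (form_adj M hij.symm)

/-! ### The values of τ on the vectors of a rank two subsystem. -/

section Pair

variable {i j : I} {γ : PosRoot M}

theorem tau_simpleRoot_of_not_adj (hij : i ≠ j) (hn : ¬ M.Adj i j) :
    tau M j (xv M (simpleRoot M i)) =
      op (h M (simpleRoot M i) j) • xv M (simpleRoot M i) :=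
  tau_zero (form_not_adj M hij.symm fun h => hn h.symm)

theorem tau_simpleRoot_of_adj (hij : M.Adj i j) (hγ : γ.1 = simple i + simple j) :
    tau M j (xv M (simpleRoot M i)) = xv M γ - op (mZ M) • xv M (simpleRoot M i) :=
  tau_add (form_adj M hij.symm) hγ

theorem tau_add_simpleRoot (hij : M.Adj i j) (hγ : γ.1 = simple i + simple j) :
    tau M i (xv M γ) = xv M (simpleRoot M j) := by
  refine tau_sub ?_ (γ := simpleRoot M j) ?_
  · rw [hγ, form_add_right, form_self, form_adj M hij]; rfl
  · rw [hγ]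
    change simple j = _
    abel

theorem simpleRoot_ne_add (hγ : γ.1 = simple i + simple j) (k : I) : simpleRoot M k ≠ γ := by
  rintro rfl
  have := congrArg ht hγ
  change ht (simple k) = _ at this
  rw [map_add, ht_simple, ht_simple, ht_simple] at this
  omega

end Pair

/-! ### Compatible functionals give a representation. -/

section Forward

variable {T : I → PosRoot M → Z₀ M} {φ : I → Functional M}
  (hφ : ∀ i β, φ i (xv M β) = T i β) (hc : IsCompatible φ)

include hφ hc

theorem IsCompatible.sigma_comm {i j : I} (hn : ¬ M.Adj i j) :
    sigma M T i * sigma M T j = sigma M T j * sigma M T i := by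
  by_cases hij : i = j
  · rw [hij]
  have hn' : ¬ M.Adj j i := fun h => hn h.symm
  refine LinearMap.ext fun v => ?_
  simp only [Module.End.mul_apply, sigma_apply hφ, map_add, LinearMap.map_smul_of_tower, map_smul,
    tau_simpleRoot_of_not_adj hij hn, tau_simpleRoot_of_not_adj (Ne.symm hij) hn',
    hc.comm i j hij hn, hc.comm j i (Ne.symm hij) hn', hc.off_diag i j hij,
    hc.off_diag j i (Ne.symm hij), tau_comm_apply hn, smul_zero, op_add, op_smul, op_zero,
    zero_smul, add_zero, smul_smul, ← op_mul]
  abel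

theorem IsCompatible.sigma_braid {i j : I} (hij : M.Adj i j) :
    sigma M T i * sigma M T j * sigma M T i = sigma M T j * sigma M T i * sigma M T j := by
  obtain ⟨γ, hγ⟩ := exists_add_simpleRoot hij
  have hγ' : γ.1 = simple j + simple i := by rw [hγ, add_comm]
  have h1 := hc.off_diag i j hij.ne
  have h2 := hc.off_diag j i hij.ne'
  refine LinearMap.ext fun v => ?_
  -- All terms in l⁻² and l⁻³ vanish, because φ_j(x_{α_i}), φ_i(x_{α_j}) and φ_i(τ_j x_{α_i}) are
  -- zero. The result is symmetric in i and j once the braid relation for τ and φ_j τ_i = φ_i τ_j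
  -- are used.
  have key : ∀ (i j : I), M.Adj i j → γ.1 = simple i + simple j →
      sigma M T i (sigma M T j (sigma M T i v)) = tau M i (tau M j (tau M i v)) +
        linv₀ • (op (φ i v) • xv M (simpleRoot M j) + op (φ j v) • xv M (simpleRoot M i)
          + op (φ j (tau M i v)) • (xv M γ - op (mZ M) • xv M (simpleRoot M j)
          - op (mZ M) • xv M (simpleRoot M i))) := by
    intro i j hij hγ
    have hγ' : γ.1 = simple j + simple i := by rw [hγ, add_comm]
    have h1 := hc.off_diag i j hij.ne
    have h2 := hc.off_diag j i hij.ne'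
    have h3 : φ i (tau M j (tau M i v)) = φ j v - mZ M * φ j (tau M i v) := by
      rw [hc.adj i j hij, Functional.apply_tau_tau h2]
    have h4 : φ i (tau M j (xv M (simpleRoot M i))) = 0 := by
      rw [hc.adj i j hij, tau_self, map_zero]
    rw [tau_simpleRoot_of_adj hij hγ, map_sub, Functional.map_op_smul, hc.diag, one_mul,
      sub_eq_zero] at h4
    simp only [sigma_apply hφ, map_add, map_sub, LinearMap.map_smul_of_tower, map_smul,
      tau_simpleRoot_of_adj hij hγ, tau_simpleRoot_of_adj hij.symm hγ', tau_add_simpleRoot hij hγ,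
      tau_self, h1, h2, h3, h4, hc.diag, smul_zero, smul_add, smul_sub, op_smul_eq_mul, one_mul,
      sub_self, sub_zero, add_zero, op_sub, sub_smul, op_mul, mul_smul]
    abel
  simp only [Module.End.mul_apply]
  rw [key i j hij hγ, key j i hij.symm hγ', tau_braid_apply hij, hc.adj j i hij.symm]
  simp only [smul_sub, smul_add]
  abel

end Forward

/-! ### A representation with coefficients in Z₀⁽¹⁾ comes from compatible functionals. -/

section Backward

variable {T : I → PosRoot M → Z₀ M} {φ : I → Functional M}
  (hφ : ∀ i β, φ i (xv M β) = T i β)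

include hφ

/-- These are the coefficients of l⁻¹ and l⁻² in the coordinate at α_i of the commutation relation
applied to x_β. -/
theorem comm_of_sigma_comm (hT : ∀ i β, T i β ∈ Z₁ M) {i j : I} (hij : i ≠ j) (hn : ¬ M.Adj i j)
    (hσ : sigma M T i * sigma M T j = sigma M T j * sigma M T i) (β : PosRoot M) :
    φ i (tau M j (xv M β)) = h M (simpleRoot M i) j * φ i (xv M β) ∧
      φ i (xv M (simpleRoot M j)) * φ j (xv M β) = 0 := by
  have hn' : ¬ M.Adj j i := fun h => hn h.symm
  have hmem : ∀ i β, φ i (xv M β) ∈ Z₁ M := fun i β => by rw [hφ]; exact hT i β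
  have h0 := congrArg (coord M (simpleRoot M i)) (LinearMap.congr_fun hσ (xv M β))
  have hji : simpleRoot M j ≠ simpleRoot M i := fun h => hij (simpleRoot_injective h).symm
  simp only [Module.End.mul_apply, sigma_apply hφ, map_add, LinearMap.map_smul_of_tower, map_smul,
    tau_simpleRoot_of_not_adj hij hn, tau_simpleRoot_of_not_adj (Ne.symm hij) hn',
    tau_comm_apply hn, coord_xv_self, coord_xv_ne hji, smul_zero, add_zero, op_smul_eq_mul,
    one_mul, zero_mul, smul_add, mul_add, add_assoc, add_right_inj] at h0
  have := eq_zero_of_linv₀_smul (M := M)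
    (a := φ i (tau M j (xv M β)) - h M (simpleRoot M i) j * φ i (xv M β))
    (b := φ i (xv M (simpleRoot M j)) * φ j (xv M β)) (c := 0)
    (sub_mem (Functional.apply_tau_mem (hmem i) j β) (mul_mem (h_mem _ _) (hmem i β)))
    (mul_mem (hmem _ _) (hmem _ _)) (zero_mem _) (by
      rw [smul_sub, ← h0, pow_two, mul_smul, smul_zero]
      abel)
  exact ⟨sub_eq_zero.1 this.1, this.2⟩

/-- Take the coordinate at α_i + α_j: the terms in τ alone cancel, and the coefficient of l⁻¹ is the
difference of the two sides. -/
theorem adj_of_sigma_braid (hT : ∀ i β, T i β ∈ Z₁ M) {i j : I} (hij : M.Adj i j)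
    (hσ : sigma M T i * sigma M T j * sigma M T i = sigma M T j * sigma M T i * sigma M T j)
    (β : PosRoot M) : φ i (tau M j (xv M β)) = φ j (tau M i (xv M β)) := by
  have hmem : ∀ i β, φ i (xv M β) ∈ Z₁ M := fun i β => by rw [hφ]; exact hT i β
  obtain ⟨γ, hγ⟩ := exists_add_simpleRoot hij
  have hγ' : γ.1 = simple j + simple i := by rw [hγ, add_comm]
  have h0 := congrArg (coord M γ) (LinearMap.congr_fun hσ (xv M β))
  simp only [Module.End.mul_apply, sigma_apply hφ, map_add, map_sub, LinearMap.map_smul_of_tower,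
    map_smul,
    tau_simpleRoot_of_adj hij hγ, tau_simpleRoot_of_adj hij.symm hγ', tau_add_simpleRoot hij hγ,
    tau_add_simpleRoot hij.symm hγ', tau_self,
    tau_braid_apply hij, coord_xv_self, coord_xv_ne (simpleRoot_ne_add hγ _),
    smul_zero, add_zero, sub_zero, op_smul_eq_mul,
    one_mul, zero_mul, smul_add, mul_add, add_assoc, add_right_inj] at h0
  refine (sub_eq_zero.1 (eq_zero_of_linv₀_smul (M := M)
    (a := φ j (tau M i (xv M β)) - φ i (tau M j (xv M β)))
    (b := φ j (xv M (simpleRoot M i)) * φ i (xv M β) -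
      φ i (xv M (simpleRoot M j)) * φ j (xv M β)) (c := 0)
    (sub_mem (Functional.apply_tau_mem (hmem j) i β) (Functional.apply_tau_mem (hmem i) j β))
    (sub_mem (mul_mem (hmem _ _) (hmem _ _)) (mul_mem (hmem _ _) (hmem _ _))) (zero_mem _) ?_).1).symm
  simp only [zero_add, smul_mul_assoc] at h0
  rw [smul_sub, smul_sub, pow_two, mul_smul, mul_smul, smul_zero, add_zero]
  rw [← sub_eq_zero] at h0
  rw [← h0]
  abel

/-- Apply the braid relation to x_{α_i} and take the coordinate at α_i. Once φ_i(x_{α_i+α_j}) is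
eliminated by the adjacency condition, the coefficient of l⁻¹ is φ_j(x_{α_i}). -/
theorem off_diag_of_sigma_braid (hT : ∀ i β, T i β ∈ Z₁ M) (h1 : ∀ i, T i (simpleRoot M i) = 1)
    {i j : I} (hij : M.Adj i j)
    (hσ : sigma M T i * sigma M T j * sigma M T i = sigma M T j * sigma M T i * sigma M T j)
    (hadj : φ i (tau M j (xv M (simpleRoot M i))) = φ j (tau M i (xv M (simpleRoot M i)))) :
    φ j (xv M (simpleRoot M i)) = 0 := by
  have hmem : ∀ i β, φ i (xv M β) ∈ Z₁ M := fun i β => by rw [hφ]; exact hT i β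
  obtain ⟨γ, hγ⟩ := exists_add_simpleRoot hij
  have hγ' : γ.1 = simple j + simple i := by rw [hγ, add_comm]
  have hd : ∀ i, φ i (xv M (simpleRoot M i)) = 1 := fun i => by rw [hφ, h1]
  have hji : simpleRoot M j ≠ simpleRoot M i := fun h => hij.ne (simpleRoot_injective h).symm
  have h0 := congrArg (coord M (simpleRoot M i))
    (LinearMap.congr_fun hσ (xv M (simpleRoot M i)))
  rw [tau_self, map_zero, tau_simpleRoot_of_adj hij hγ, map_sub, Functional.map_op_smul, hd,
    one_mul, sub_eq_zero] at hadj
  simp only [Module.End.mul_apply, sigma_apply hφ, map_add, map_sub, LinearMap.map_smul_of_tower,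
    map_smul,
    tau_simpleRoot_of_adj hij hγ, tau_simpleRoot_of_adj hij.symm hγ', tau_add_simpleRoot hij hγ,
    tau_add_simpleRoot hij.symm hγ', tau_self, hd, hadj,
    coord_xv_self, coord_xv_ne hji, coord_xv_ne (simpleRoot_ne_add hγ _).symm,
    smul_zero, add_zero, zero_add, sub_zero, zero_sub, sub_self, op_zero, op_smul_eq_mul,
    one_mul, zero_mul, smul_add, mul_add, add_assoc, add_right_inj] at h0
  refine (eq_zero_of_linv₀_smul (M := M) (a := φ j (xv M (simpleRoot M i)))
    (b := -mZ M * φ i (xv M (simpleRoot M j)) * φ j (xv M (simpleRoot M i)))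
    (c := -(φ i (xv M (simpleRoot M j)) * φ j (xv M (simpleRoot M i))))
    (hmem _ _) (mul_mem (mul_mem (neg_mem mZ_mem) (hmem _ _)) (hmem _ _))
    (neg_mem (mul_mem (hmem _ _) (hmem _ _))) ?_).1
  simp only [mul_one, smul_mul_assoc, sub_self, zero_add] at h0
  rw [show linv₀ ^ 3 = linv₀ * (linv₀ * linv₀) by ring, pow_two, mul_smul, mul_smul, mul_smul, smul_neg, smul_neg, smul_neg, h0]
  abel

/-- A family with coefficients in `Z₀⁽¹⁾` that satisfies the relations of the Artin group is
compatible. -/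
theorem isCompatible_of_sigma (hT : ∀ i β, T i β ∈ Z₁ M) (h1 : ∀ i, T i (simpleRoot M i) = 1)
    (hcomm : ∀ i j, ¬ M.Adj i j → sigma M T i * sigma M T j = sigma M T j * sigma M T i)
    (hbraid : ∀ i j, M.Adj i j →
      sigma M T i * sigma M T j * sigma M T i = sigma M T j * sigma M T i * sigma M T j) :
    IsCompatible φ where
  diag i := by rw [hφ, h1]
  off_diag i j hij := by
    by_cases hn : M.Adj i j
    · exact off_diag_of_sigma_braid hφ hT h1 hn.symm (hbraid j i hn.symm)
        (adj_of_sigma_braid hφ hT hn.symm (hbraid j i hn.symm) _)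
    · have := (comm_of_sigma_comm hφ hT hij hn (hcomm i j hn) (simpleRoot M j)).2
      rwa [hφ j, h1, mul_one] at this
  comm i j hij hn v := by
    have : φ i ∘ₗ tau M j = h M (simpleRoot M i) j • φ i := ext_xv fun β =>
      (comm_of_sigma_comm hφ hT hij hn (hcomm i j hn) β).1
    exact LinearMap.congr_fun this v
  adj i j hij v := by
    have : φ i ∘ₗ tau M j = φ j ∘ₗ tau M i := ext_xv fun β =>
      adj_of_sigma_braid hφ hT hij (hbraid i j hij) β
    exact LinearMap.congr_fun this v

end Backward

/-! ### The relations of the BMW algebra -/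

section BMWRelations

variable (M) in
/-- The element `σ_i² + m σ_i - 1`, a scalar multiple of the image of `e_i`. -/
def quadSigma (T : I → PosRoot M → Z₀ M) (i : I) : Module.End (Z₀ M)ᵐᵒᵖ (V₀ M) :=
  sigma M T i * sigma M T i + m₀ • sigma M T i - 1

theorem tau_tau (i : I) (v : V₀ M) : tau M i (tau M i v) =
    v - op (coord M (simpleRoot M i) v) • xv M (simpleRoot M i) - m₀ • tau M i v := by
  let f : Module.End (Z₀ M)ᵐᵒᵖ (V₀ M) :=
    { toFun := fun v => v - op (coord M (simpleRoot M i) v) • xv M (simpleRoot M i) - m₀ • tau M i v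
      map_add' := fun u v => by
        simp only [map_add, op_add, add_smul, smul_add]
        abel
      map_smul' := fun a v => by
        rw [map_smul, map_smul, RingHom.id_apply, smul_sub, smul_sub, smul_smul, smul_comm m₀]; rfl }
  have : tau M i * tau M i = f := ext_xv fun β => by
    change tau M i (tau M i (xv M β)) = xv M β -
      op (coord M (simpleRoot M i) (xv M β)) • xv M (simpleRoot M i) - m₀ • tau M i (xv M β)
    by_cases hβ : β = simpleRoot M i
    · rw [hβ, coord_xv_self, tau_self, map_zero, op_one, one_smul, sub_self, smul_zero, sub_zero]
    · rw [tau_tau_xv hβ, coord_xv_ne hβ, op_zero, zero_smul, sub_zero, smul_R₀_eq]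
  exact LinearMap.congr_fun this v

variable {T : I → PosRoot M → Z₀ M} {φ : I → Functional M}
  (hφ : ∀ i β, φ i (xv M β) = T i β) (hc : IsCompatible φ)

variable (φ) in
/-- The functional `ε` for which `(σ_i² + m σ_i - 1) v = x_{α_i} ε(v)`. -/
def epsilon (i : I) : Functional M :=
  linv₀ • (φ i ∘ₗ tau M i) + (linv₀ * linv₀ + linv₀ * m₀) • φ i - coord M (simpleRoot M i)

theorem epsilon_apply (i : I) (v : V₀ M) : epsilon φ i v = linv₀ • φ i (tau M i v) +
    (linv₀ * linv₀ + linv₀ * m₀) • φ i v - coord M (simpleRoot M i) v := rfl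

include hφ hc

theorem IsCompatible.sigma_simpleRoot (i : I) :
    sigma M T i (xv M (simpleRoot M i)) = linv₀ • xv M (simpleRoot M i) := by
  rw [sigma_apply hφ, tau_self, hc.diag, zero_add, op_one, one_smul]

/-- The quadratic relation for τ_i fails only by the projection to x_{α_i}, and the perturbation
also has its image there. So the result has rank one, and the BMW relations reduce to values of ε.
-/
theorem IsCompatible.quadSigma_apply (i : I) (v : V₀ M) :
    quadSigma M T i v = op (epsilon φ i v) • xv M (simpleRoot M i) := by
  have h1 : quadSigma M T i v =
    sigma M T i (sigma M T i v) + m₀ • sigma M T i v - v := rfl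
  rw [h1, sigma_apply hφ i v, map_add, LinearMap.map_smul_of_tower, map_smul,
    hc.sigma_simpleRoot hφ, sigma_apply hφ i (tau M i v), tau_tau, epsilon_apply]
  simp only [op_add, op_sub, op_smul, add_smul, sub_smul, smul_add, smul_smul, smul_assoc,
    smul_comm _ linv₀]
  abel

theorem IsCompatible.sigma_mul_quadSigma (i : I) :
    sigma M T i * quadSigma M T i = linv₀ • quadSigma M T i := by
  refine LinearMap.ext fun v => ?_
  rw [Module.End.mul_apply, LinearMap.smul_apply, hc.quadSigma_apply hφ, map_smul,
    hc.sigma_simpleRoot hφ, smul_comm]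

theorem IsCompatible.quadSigma_mul_quadSigma {i j : I} (hij : i ≠ j) (hn : ¬ M.Adj i j) :
    quadSigma M T i * quadSigma M T j = 0 := by
  refine LinearMap.ext fun v => ?_
  have hn' : ¬ M.Adj j i := fun h => hn h.symm
  have hji : simpleRoot M j ≠ simpleRoot M i := fun h => hij (simpleRoot_injective h).symm
  rw [Module.End.mul_apply, LinearMap.zero_apply, hc.quadSigma_apply hφ j, map_smul,
    hc.quadSigma_apply hφ i, epsilon_apply i, tau_simpleRoot_of_not_adj (Ne.symm hij) hn',
    Functional.map_op_smul, hc.off_diag i j hij, coord_xv_ne hji]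
  simp

theorem IsCompatible.quadSigma_sigma_quadSigma {i j : I} (hij : M.Adj i j) :
    quadSigma M T i * sigma M T j * quadSigma M T i = m₀ • quadSigma M T i := by
  obtain ⟨γ, hγ⟩ := exists_add_simpleRoot hij
  refine LinearMap.ext fun v => ?_
  have h4 : φ i (tau M j (xv M (simpleRoot M i))) = 0 := by
    rw [hc.adj i j hij, tau_self, map_zero]
  rw [tau_simpleRoot_of_adj hij hγ, map_sub, Functional.map_op_smul, hc.diag, one_mul,
    sub_eq_zero] at h4
  -- Since σ_j x_{α_i} = x_{α_i+α_j} - x_{α_i} m and φ_i(x_{α_i+α_j}) = m, the φ_i parts cancel, and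
  -- m remains from the coordinate term of ε.
  have h5 : epsilon φ i (sigma M T j (xv M (simpleRoot M i))) = mZ M := by
    rw [sigma_apply hφ, hc.off_diag j i hij.ne', op_zero, zero_smul, smul_zero, add_zero,
      tau_simpleRoot_of_adj hij hγ, map_sub, Functional.map_op_smul, epsilon_apply, epsilon_apply,
      tau_add_simpleRoot hij hγ, hc.off_diag i j hij.ne, tau_self, map_zero, h4, hc.diag,
      coord_xv_self, coord_xv_ne (simpleRoot_ne_add hγ i).symm]
    simp only [smul_zero, zero_add, sub_mul, smul_mul_assoc, one_mul]
    abel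
  rw [Module.End.mul_apply, Module.End.mul_apply, LinearMap.smul_apply,
    hc.quadSigma_apply hφ i v, map_smul, map_smul, hc.quadSigma_apply hφ i, h5, smul_R₀_eq,
    smul_smul, smul_smul, ← op_mul, ← op_mul, mZ_comm]

end BMWRelations

end Sigma

/-! ### The diagrams of type `A`, `D` and `E` -/

section ADE

/-- A certificate for a Cartan matrix indexed by `Fin n`: a positive vector with positive image,
and a spanning tree rooted at the first node, with the distance to the root. -/
structure Certificate {n : ℕ} (c : Matrix (Fin n) (Fin n) ℤ) : Prop where
  exists_pos : ∃ u : Fin n → ℤ, (∀ i, 0 < u i) ∧ ∀ i, 0 < ∑ j, c i j * u j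
  exists_tree : ∃ (dist : Fin n → ℕ) (parent : Fin n → Fin n),
    ∀ i : Fin n, (i : ℕ) ≠ 0 → dist (parent i) < dist i ∧ c i (parent i) ≠ 0
  pos : 0 < n

variable {I : Type*} [Fintype I] [DecidableEq I] {M : SimpleGraph I}

theorem Certificate.finiteType {n : ℕ} {c : Matrix (Fin n) (Fin n) ℤ} (h : Certificate c)
    (e : I ≃ Fin n) (he : Matrix.reindex e e (cartan M) = c) : FiniteType M where
  exists_pos := by
    obtain ⟨u, hu, hc⟩ := h.exists_pos
    refine ⟨fun i => u (e i), fun i => hu _, fun i => ?_⟩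
    rw [form_simple_left]
    have := hc (e i)
    rw [← he, ← e.sum_comp] at this
    simpa using this
  connected S hS hclosed := by
    obtain ⟨dist, parent, htree⟩ := h.exists_tree
    have hadj : ∀ i : Fin n, (i : ℕ) ≠ 0 → dist (parent i) < dist i ∧
        M.Adj (e.symm i) (e.symm (parent i)) := by
      intro i hi
      obtain ⟨hlt, hne⟩ := htree i hi
      refine ⟨hlt, by_contra fun hn => hne ?_⟩
      rw [← he]
      refine cartan_of_not_adj M (fun h => ?_) hn
      rw [← e.symm.injective h] at hlt
      exact lt_irrefl _ hlt
    let z : Fin n := ⟨0, h.pos⟩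
    have key : ∀ k (i : Fin n), dist i = k → (e.symm i ∈ S ↔ e.symm z ∈ S) := by
      intro k
      induction k using Nat.strong_induction_on with
      | _ k ih =>
        intro i hi
        by_cases h0 : (i : ℕ) = 0
        · have : i = z := Fin.ext h0
          rw [this]
        · obtain ⟨hlt, ha⟩ := hadj i h0
          rw [← ih _ (hi ▸ hlt) (parent i) rfl]
          exact ⟨fun h => hclosed _ _ h ha, fun h => hclosed _ _ h ha.symm⟩
    obtain ⟨s, hs⟩ := hS
    have hz : e.symm z ∈ S := (key _ (e s) rfl).1 (by simpa using hs)
    refine Set.eq_univ_of_forall fun i => ?_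
    simpa using (key _ (e i) rfl).2 hz
  nonempty := ⟨e.symm ⟨0, h.pos⟩⟩

theorem sum_fin_ite (n k : ℕ) (w : ℕ → ℤ) :
    ∑ j : Fin n, (if (j : ℕ) = k then w j else 0) = if k < n then w k else 0 := by
  rw [Fin.sum_univ_eq_sum_range (fun j => if j = k then w j else 0) n]
  simp [Finset.sum_ite_eq']

theorem certificate_A {n : ℕ} (hn : 1 ≤ n) : Certificate (CartanMatrix.A n) where
  exists_pos := by
    -- The coordinates of the sum of the positive roots, whose product with every simple root is 2.
    let w : ℕ → ℤ := fun j => (j + 1) * (n - j)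
    refine ⟨fun i => w i, fun i => ?_, fun i => ?_⟩
    · have := i.2
      have h1 : (0 : ℤ) < n - (i : ℕ) := by omega
      simp only [w]
      positivity
    · have hi := i.2
      -- The first node has no left neighbour; the index n is out of range and so contributes 0. On
      -- the right, w(n) = 0 anyway.
      have h1 : ∀ j : Fin n, CartanMatrix.A n i j * w j =
          2 * (if (j : ℕ) = i then w j else 0) - (if (j : ℕ) = i + 1 then w j else 0) -
            (if (j : ℕ) = if (i : ℕ) = 0 then n else i - 1 then w j else 0) := by
        intro j
        have := j.2
        simp only [CartanMatrix.A, Matrix.of_apply, Fin.ext_iff]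
        split_ifs <;> omega
      simp only [h1, Finset.sum_sub_distrib, ← Finset.mul_sum, sum_fin_ite]
      have h2 : (if (i : ℕ) + 1 < n then w (i + 1) else 0) = w (i + 1) := by
        split_ifs with h
        · rfl
        · have : (n : ℤ) = i + 1 := by omega
          simp [w, this]
      rw [if_pos hi, h2]
      by_cases h0 : (i : ℕ) = 0
      · simp only [h0, if_pos, lt_irrefl, if_false, w]
        push_cast
        have : (1 : ℤ) ≤ n := by exact_mod_cast hn
        linarith
      · obtain ⟨k, hk⟩ := Nat.exists_eq_succ_of_ne_zero h0
        rw [if_neg h0, if_pos (by omega), hk]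
        simp only [w, Nat.succ_eq_add_one, Nat.add_sub_cancel]
        push_cast
        ring_nf
        norm_num
  exists_tree := ⟨fun i => i, fun i => ⟨i - 1, by omega⟩, fun i hi => by
    refine ⟨by simp only; omega, ?_⟩
    simp only [CartanMatrix.A, Matrix.of_apply, Fin.ext_iff]
    split_ifs <;> omega⟩
  pos := hn

theorem certificate_D {n : ℕ} (hn : 4 ≤ n) : Certificate (CartanMatrix.D n) where
  exists_pos := by
    have hn' : (4 : ℤ) ≤ n := by exact_mod_cast hn
    -- Twice the sum of the positive roots, to avoid halves at the two end nodes of the fork; its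
    -- product with every simple root is 4.
    let w : ℕ → ℤ := fun j => if j + 2 < n then 2 * (j + 1) * (2 * n - j - 2) else n * (n - 1)
    refine ⟨fun i => w i, fun i => ?_, fun i => ?_⟩
    · simp only [w]
      split_ifs with h
      · have h1 : (0 : ℤ) < 2 * n - (i : ℕ) - 2 := by omega
        positivity
      · have h1 : (0 : ℤ) < n - 1 := by omega
        positivity
    · have hi := i.2
      rcases (by omega : (i : ℕ) + 3 < n ∨ (i : ℕ) + 3 = n ∨ (i : ℕ) + 2 = n ∨ (i : ℕ) + 1 = n)
        with h | h | h
      · have h1 : ∀ j : Fin n, CartanMatrix.D n i j * w j =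
            2 * (if (j : ℕ) = i then w j else 0) - (if (j : ℕ) = i + 1 then w j else 0) -
              (if (j : ℕ) = if (i : ℕ) = 0 then n else i - 1 then w j else 0) := by
          intro j
          have := j.2
          simp only [CartanMatrix.D, Matrix.of_apply, Fin.ext_iff]
          split_ifs <;> omega
        simp only [h1, Finset.sum_sub_distrib, ← Finset.mul_sum, sum_fin_ite]
        rw [if_pos hi, if_pos (by omega)]
        by_cases h0 : (i : ℕ) = 0
        · simp only [h0, if_pos, lt_irrefl, if_false, w]
          rw [if_pos (by omega), if_pos (by omega)]
          push_cast
          linarith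
        · obtain ⟨k, hk⟩ := Nat.exists_eq_succ_of_ne_zero h0
          rw [if_neg h0, if_pos (by omega), hk]
          simp only [w, Nat.succ_eq_add_one, Nat.add_sub_cancel]
          rw [if_pos (by omega), if_pos (by omega), if_pos (by omega)]
          push_cast
          ring_nf
          norm_num
      · have h1 : ∀ j : Fin n, CartanMatrix.D n i j * w j =
            2 * (if (j : ℕ) = i then w j else 0) - (if (j : ℕ) = i + 1 then w j else 0) -
              (if (j : ℕ) = i + 2 then w j else 0) -
              (if (j : ℕ) = i - 1 then w j else 0) := by
          intro j
          have := j.2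
          simp only [CartanMatrix.D, Matrix.of_apply, Fin.ext_iff]
          split_ifs <;> omega
        simp only [h1, Finset.sum_sub_distrib, ← Finset.mul_sum, sum_fin_ite]
        rw [if_pos hi, if_pos (by omega), if_pos (by omega), if_pos (by omega)]
        obtain ⟨k, hk⟩ : ∃ k, (i : ℕ) = k + 1 := ⟨i - 1, by omega⟩
        have hnk : (n : ℤ) = k + 4 := by omega
        simp only [w, hk, Nat.add_sub_cancel]
        rw [if_pos (by omega), if_neg (by omega), if_neg (by omega), if_pos (by omega), hnk]
        push_cast
        ring_nf
        norm_num
      · have h1 : ∀ j : Fin n, CartanMatrix.D n i j * w j =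
            2 * (if (j : ℕ) = i then w j else 0) - (if (j : ℕ) = n - 3 then w j else 0) := by
          intro j
          have := j.2
          simp only [CartanMatrix.D, Matrix.of_apply, Fin.ext_iff]
          split_ifs <;> omega
        simp only [h1, Finset.sum_sub_distrib, ← Finset.mul_sum, sum_fin_ite]
        rw [if_pos hi, if_pos (by omega)]
        simp only [w]
        rw [if_neg (by omega), if_pos (by omega)]
        obtain ⟨k, rfl⟩ : ∃ k, n = k + 3 := ⟨n - 3, by omega⟩
        simp only [Nat.add_sub_cancel]
        push_cast
        ring_nf
        norm_num
  exists_tree := by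
    -- The last node is attached to the branch node n - 3, every other node to its predecessor.
    refine ⟨fun i => i, fun i => ⟨if (i : ℕ) + 1 = n then i - 2 else i - 1, by split_ifs <;> omega⟩,
      fun i hi => ?_⟩
    have := i.2
    simp only [CartanMatrix.D, Matrix.of_apply, Fin.ext_iff]
    by_cases h : (i : ℕ) + 1 = n
    · simp only [if_pos h]
      refine ⟨by omega, ?_⟩
      split_ifs <;> omega
    · simp only [if_neg h]
      refine ⟨by omega, ?_⟩
      split_ifs <;> omega
  pos := by omega

/-- In the three exceptional cases the vector is again the sum of the positive roots, and the tree
is the diagram itself, with the second node hanging from the fourth. -/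
theorem certificate_E₆ : Certificate CartanMatrix.E₆ where
  exists_pos := ⟨![16, 22, 30, 42, 30, 16], by decide, by decide⟩
  exists_tree := ⟨![0, 3, 1, 2, 3, 4], ![0, 3, 0, 2, 3, 4], by decide⟩
  pos := by norm_num

theorem certificate_E₇ : Certificate CartanMatrix.E₇ where
  exists_pos := ⟨![34, 49, 66, 96, 75, 52, 27], by decide, by decide⟩
  exists_tree := ⟨![0, 3, 1, 2, 3, 4, 5], ![0, 3, 0, 2, 3, 4, 5], by decide⟩
  pos := by norm_num

theorem certificate_E₈ : Certificate CartanMatrix.E₈ where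
  exists_pos := ⟨![92, 136, 182, 270, 220, 168, 114, 58], by decide, by decide⟩
  exists_tree := ⟨![0, 3, 1, 2, 3, 4, 5, 6], ![0, 3, 0, 2, 3, 4, 5, 6], by decide⟩
  pos := by norm_num

theorem IsADE.finiteType (h : IsADE M) : FiniteType M := by
  rcases h with ⟨n, hn, e, he⟩ | ⟨n, hn, e, he⟩ | ⟨e, he⟩ | ⟨e, he⟩ | ⟨e, he⟩
  · exact (certificate_A hn).finiteType e he
  · exact (certificate_D hn).finiteType e he
  · exact certificate_E₆.finiteType e he
  · exact certificate_E₇.finiteType e he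
  · exact certificate_E₈.finiteType e he

end ADE

/-! ### The representation of the Artin group -/

section Invertible

/-- An element that satisfies a cubic relation with invertible constant term is invertible. -/
theorem isUnit_of_cubic {R A : Type*} [CommRing R] [Ring A] [Algebra R A] {a : A} {c r r' : R}
    (hr : r' * r = 1) (ha : a * (a * a + c • a - 1) = r • (a * a + c • a - 1)) : IsUnit a := by
  -- The cubic is (a - r)(a² + ca - 1), with constant term r; moving that term to the other side
  -- exhibits an inverse up to sign and scalar.
  have h1 : a * (a * a + c • a - 1 - r • a - (r * c) • 1) = -(r • (1 : A)) := by
    rw [mul_sub, mul_sub, ha]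
    simp only [smul_sub, smul_add, mul_smul_comm, mul_one, smul_smul]
    abel
  have h2 : (a * a + c • a - 1 - r • a - (r * c) • 1) * a = -(r • (1 : A)) := by
    rw [← h1]
    simp only [mul_sub, mul_add, sub_mul, add_mul, mul_smul_comm, smul_mul_assoc, mul_one, one_mul,
      mul_assoc]
  refine isUnit_iff_exists.2 ⟨-(r' • (a * a + c • a - 1 - r • a - (r * c) • 1)), ?_, ?_⟩
  · rw [mul_neg, mul_smul_comm, h1, smul_neg, neg_neg, smul_smul, hr, one_smul]
  · rw [neg_mul, smul_mul_assoc, h2, smul_neg, neg_neg, smul_smul, hr, one_smul]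

/-- A family of invertible elements of a monoid that satisfies the braid relations extends to the
Artin group. -/
theorem exists_artin_units {I A : Type*} [Monoid A] {M : SimpleGraph I} {f : I → A}
    (hu : ∀ i, IsUnit (f i)) (hc : ∀ i j, ¬ M.Adj i j → f i * f j = f j * f i)
    (hb : ∀ i j, M.Adj i j → f i * f j * f i = f j * f i * f j) :
    ∃ γ : Artin M →* Aˣ, ∀ i, (γ (s M i) : A) = f i := by
  refine ⟨Artin.lift (fun i => (hu i).unit) (fun i j h => ?_) (fun i j h => ?_), fun i => ?_⟩
  · ext; simpa using hc i j h
  · ext; simpa using hb i j h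
  · rw [Artin.lift_s]; rfl

end Invertible

/-! ### The BMW algebra -/

section BMWAlgebra

variable {I : Type*} (M : SimpleGraph I)

theorem g_comm {i j : I} (h : ¬ M.Adj i j) : g M i * g M j = g M j * g M i := by
  have := RingQuot.mkAlgHom_rel K (BMWRel.B1 i j h)
  simp only [map_mul] at this
  exact this

theorem g_braid {i j : I} (h : M.Adj i j) : g M i * g M j * g M i = g M j * g M i * g M j := by
  have := RingQuot.mkAlgHom_rel K (BMWRel.B2 i j h)
  simp only [map_mul] at this
  exact this

theorem m_smul_e (i : I) : m • e M i = l • (g M i * g M i + m • g M i - 1) := by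
  have := RingQuot.mkAlgHom_rel K (BMWRel.D1 (M := M) i)
  simp only [map_mul, map_smul, map_add, map_sub, map_one] at this
  exact this

theorem g_mul_e (i : I) : g M i * e M i = l⁻¹ • e M i := by
  have := RingQuot.mkAlgHom_rel K (BMWRel.R1 (M := M) i)
  simp only [map_mul, map_smul] at this
  exact this

theorem isUnit_g (i : I) : IsUnit (g M i) := by
  have h1 : g M i * g M i + m • g M i - 1 = (l⁻¹ * m) • e M i := by
    rw [mul_smul, m_smul_e, smul_smul, inv_mul_cancel₀ l_ne_zero, one_smul]
  refine isUnit_of_cubic (R := K) (A := BMW M) (c := m) (r := l⁻¹) (r' := l) (mul_inv_cancel₀ l_ne_zero) ?_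
  rw [h1, mul_smul_comm, g_mul_e, smul_comm]

/-- The universal property of the quotient of the BMW algebra by the ideal `I₂`. -/
theorem exists_BMWModI₂_hom {A : Type*} [Ring A] [Algebra K A] (G E : I → A)
    (hB1 : ∀ i j, ¬ M.Adj i j → G i * G j = G j * G i)
    (hB2 : ∀ i j, M.Adj i j → G i * G j * G i = G j * G i * G j)
    (hD1 : ∀ i, m • E i = l • (G i * G i + m • G i - 1))
    (hR1 : ∀ i, G i * E i = l⁻¹ • E i)
    (hR2 : ∀ i j, M.Adj i j → E i * G j * E i = l • E i)
    (hI : ∀ i j, i ≠ j → ¬ M.Adj i j → E i * E j = 0) :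
    ∃ φ : BMWModI₂ M →ₐ[K] A, ∀ i, φ (g M i : BMWModI₂ M) = G i := by
  let f₀ : FreeAlgebra K (I ⊕ I) →ₐ[K] A := FreeAlgebra.lift K (Sum.elim G E)
  have hg : ∀ i, f₀ (fg i) = G i := fun i => FreeAlgebra.lift_ι_apply _ _
  have he : ∀ i, f₀ (fe i) = E i := fun i => FreeAlgebra.lift_ι_apply _ _
  have H : ∀ ⦃a b⦄, BMWRel M a b → f₀ a = f₀ b := by
    rintro _ _ (⟨i, j, h⟩ | ⟨i, j, h⟩ | ⟨i⟩ | ⟨i⟩ | ⟨i, j, h⟩) <;>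
      simp only [map_mul, map_smul, map_add, map_sub, map_one, hg, he]
    · exact hB1 i j h
    · exact hB2 i j h
    · exact hD1 i
    · exact hR1 i
    · exact hR2 i j h
  let f₁ : BMW M →ₐ[K] A := RingQuot.liftAlgHom K ⟨f₀, H⟩
  have hg₁ : ∀ i, f₁ (g M i) = G i := fun i =>
    (RingQuot.liftAlgHom_mkAlgHom_apply _ _ H _).trans (hg i)
  have he₁ : ∀ i, f₁ (e M i) = E i := fun i =>
    (RingQuot.liftAlgHom_mkAlgHom_apply _ _ H _).trans (he i)
  have hle : (I₂ M).ringCon ≤ RingCon.ker f₁.toRingHom := by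
    refine RingCon.ringConGen_le.2 fun a b hab => ?_
    obtain ⟨i, j, hij, hn, h⟩ := hab
    refine (RingCon.ker_apply _).2 ?_
    change f₁ a = f₁ b
    rw [sub_eq_iff_eq_add.1 h, map_add, map_mul, he₁, he₁, hI i j hij hn, zero_add]
  exact ⟨RingCon.liftₐ (R := K) (I₂ M).ringCon f₁ hle, fun i => hg₁ i⟩

/-- A variant of `exists_BMWModI₂_hom`, in terms of the elements `Q i = m l⁻¹ E i`. -/
theorem exists_BMWModI₂_hom_of_quad {A : Type*} [Ring A] [Algebra K A] (G Q : I → A)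
    (hB1 : ∀ i j, ¬ M.Adj i j → G i * G j = G j * G i)
    (hB2 : ∀ i j, M.Adj i j → G i * G j * G i = G j * G i * G j)
    (hQ : ∀ i, Q i = G i * G i + m • G i - 1)
    (hR1 : ∀ i, G i * Q i = l⁻¹ • Q i)
    (hR2 : ∀ i j, M.Adj i j → Q i * G j * Q i = m • Q i)
    (hI : ∀ i j, i ≠ j → ¬ M.Adj i j → Q i * Q j = 0) :
    ∃ φ : BMWModI₂ M →ₐ[K] A, ∀ i, φ (g M i : BMWModI₂ M) = G i := by
  have hlm : l * m⁻¹ * m = l := by rw [mul_assoc, inv_mul_cancel₀ m_ne_zero, mul_one]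
  refine exists_BMWModI₂_hom M G (fun i => (l * m⁻¹) • Q i) hB1 hB2 (fun i => ?_) (fun i => ?_)
    (fun i j h => ?_) (fun i j hij h => ?_)
  · rw [smul_smul, mul_comm m, hlm, hQ]
  · rw [mul_smul_comm, hR1, smul_comm]
  · rw [smul_mul_assoc, smul_mul_assoc, mul_smul_comm, hR2 i j h, smul_smul (l * m⁻¹) m, hlm,
      smul_comm]
  · rw [smul_mul_assoc, mul_smul_comm, hI i j hij h, smul_zero, smul_zero]

/-- A homomorphism on the quotient of the BMW algebra by `I₂` that agrees with a representation of
the Artin group on the generators agrees with it on the whole group. -/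
theorem BMWModI₂_hom_eq {A : Type*} [Ring A] [Algebra K A] (ψ : BMWModI₂ M →ₐ[K] A)
    (γ : Artin M →* (BMW M)ˣ) (ρ : Artin M →* A)
    (h : ∀ i, ψ ((γ (s M i) : BMW M) : BMWModI₂ M) = ρ (s M i)) (a : Artin M) :
    ψ ((γ a : BMW M) : BMWModI₂ M) = ρ a := by
  let ρ' : Artin M →* A :=
    { toFun := fun a => ψ ((γ a : BMW M) : BMWModI₂ M)
      map_one' := by rw [map_one, Units.val_one, RingCon.coe_one, map_one]
      map_mul' := fun a b => by rw [map_mul, Units.val_mul, RingCon.coe_mul, map_mul] }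
  have : ρ'.toHomUnits = ρ.toHomUnits := PresentedGroup.ext fun i => Units.ext (h i)
  exact congrArg Units.val (DFunLike.congr_fun this a)

end BMWAlgebra

/-! ### Extension of scalars -/

section Extend

variable {I : Type*} [Fintype I] [DecidableEq I] {M : SimpleGraph I}

theorem extend_tmul (f : Module.End (Z₀ M)ᵐᵒᵖ (V₀ M)) (k : K) (v : V₀ M) :
    extend M f (k ⊗ₜ[R₀] v) = k ⊗ₜ[R₀] f v :=
  rfl

theorem extend_mul (f f' : Module.End (Z₀ M)ᵐᵒᵖ (V₀ M)) :
    extend M (f * f') = extend M f * extend M f' := by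
  refine TensorProduct.AlgebraTensorModule.ext fun k v => ?_
  rw [Module.End.mul_apply, extend_tmul, extend_tmul, extend_tmul, Module.End.mul_apply]

theorem extend_one : extend M 1 = 1 := by
  refine TensorProduct.AlgebraTensorModule.ext fun k v => ?_
  rw [extend_tmul, Module.End.one_apply, Module.End.one_apply]

theorem extend_add (f f' : Module.End (Z₀ M)ᵐᵒᵖ (V₀ M)) :
    extend M (f + f') = extend M f + extend M f' := by
  refine TensorProduct.AlgebraTensorModule.ext fun k v => ?_
  rw [LinearMap.add_apply, extend_tmul, extend_tmul, extend_tmul, LinearMap.add_apply, tmul_add]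

theorem extend_sub (f f' : Module.End (Z₀ M)ᵐᵒᵖ (V₀ M)) :
    extend M (f - f') = extend M f - extend M f' := by
  refine TensorProduct.AlgebraTensorModule.ext fun k v => ?_
  rw [LinearMap.sub_apply, extend_tmul, extend_tmul, extend_tmul, LinearMap.sub_apply, tmul_sub]

theorem extend_smul (r : R₀) (f : Module.End (Z₀ M)ᵐᵒᵖ (V₀ M)) :
    extend M (r • f) = (r : K) • extend M f := by
  refine TensorProduct.AlgebraTensorModule.ext fun k v => ?_
  rw [LinearMap.smul_apply, extend_tmul, extend_tmul, LinearMap.smul_apply]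
  exact (TensorProduct.mk R₀ K (V₀ M) k).map_smul r (f v)

theorem extend_zero : extend M (0 : Module.End (Z₀ M)ᵐᵒᵖ (V₀ M)) = 0 := by
  refine TensorProduct.AlgebraTensorModule.ext fun k v => ?_
  rw [extend_tmul, LinearMap.zero_apply, LinearMap.zero_apply, tmul_zero]

/-- Extension of scalars as a homomorphism of monoids. -/
def extendHom : Module.End (Z₀ M)ᵐᵒᵖ (V₀ M) →* Module.End K (V M) where
  toFun := extend M
  map_one' := extend_one
  map_mul' := extend_mul

end Extend

end

end GenLK

open GenLK in
theorem mainTheorem3 {I : Type*} [Fintype I] [DecidableEq I] (M : SimpleGraph I)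
    (hM : IsADE M) :
    ∃ (T : I → PosRoot M → Z₀ M) (ρ : Artin M →* Module.End (Z₀ M)ᵐᵒᵖ (V₀ M)),
      -- the coefficients lie in the smaller Hecke algebra, and are normalized
      (∀ i β, T i β ∈ Z₁ M) ∧ (∀ i, T i (simpleRoot M i) = 1) ∧
      -- they define a representation of the Artin group
      IsRepFor M T ρ ∧
      -- they are the only such coefficients
      (∀ T' : I → PosRoot M → Z₀ M, (∀ i β, T' i β ∈ Z₁ M) → (∀ i, T' i (simpleRoot M i) = 1) →
        (∃ ρ' : Artin M →* Module.End (Z₀ M)ᵐᵒᵖ (V₀ M), IsRepFor M T' ρ') → T' = T) ∧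
      -- they are the unique solution of the equations for the coefficients
      TEquations M T ∧ (∀ T' : I → PosRoot M → Z₀ M, TEquations M T' → T' = T) ∧
      -- after extension of scalars, the representation factors through the quotient algebra
      ∃ γ : Artin M →* (BMW M)ˣ, (∀ i, (γ (s M i) : BMW M) = g M i) ∧
        ∃ φ : BMWModI₂ M →ₐ[K] Module.End K (V M),
          ∀ a, φ ((γ a : BMW M) : BMWModI₂ M) = extend M (ρ a) := by
  have := hM.finiteType
  let φ : I → Functional M := fun i => phi M (simpleRoot M i)
  let T : I → PosRoot M → Z₀ M := fun i β => φ i (xv M β)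
  have hφ : ∀ i β, φ i (xv M β) = T i β := fun _ _ => rfl
  have hc : IsCompatible φ := isCompatible_phi
  have hcomm : ∀ i j, ¬ M.Adj i j → sigma M T i * sigma M T j = sigma M T j * sigma M T i :=
    fun i j hn => hc.sigma_comm hφ hn
  have hbraid : ∀ i j, M.Adj i j →
      sigma M T i * sigma M T j * sigma M T i = sigma M T j * sigma M T i * sigma M T j :=
    fun i j hn => hc.sigma_braid hφ hn
  have hunit : ∀ i, IsUnit (sigma M T i) := fun i =>
    isUnit_of_cubic (R := R₀) (A := Module.End (Z₀ M)ᵐᵒᵖ (V₀ M)) l₀_mul_linv₀ (hc.sigma_mul_quadSigma hφ i)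
  obtain ⟨ρ₀, hρ₀⟩ := exists_artin_units hunit hcomm hbraid
  have hT : TEquations M T := hc.tEquations
  let ρ : Artin M →* Module.End (Z₀ M)ᵐᵒᵖ (V₀ M) := (Units.coeHom _).comp ρ₀
  refine ⟨T, ρ, fun i β => phi_xv_mem _ _, hc.diag, hρ₀, ?_, hT, fun T' hT' => hT'.unique hT, ?_⟩
  -- A competing representation makes its functionals compatible, hence its coefficients solve the
  -- T-equations, which have only one solution.
  · rintro T' hmem h1 ⟨ρ', hρ'⟩
    obtain ⟨φ', hφ'⟩ := exists_functional T'
    have hσ : ∀ i, sigma M T' i = ρ' (s M i) := fun i => (hρ' i).symm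
    have hc' : IsCompatible φ' := isCompatible_of_sigma hφ' hmem h1
      (fun i j hn => by rw [hσ, hσ, ← map_mul, ← map_mul, s_comm hn])
      (fun i j hn => by simp only [hσ, ← map_mul, s_braid hn])
    have hT' := hc'.tEquations
    simp only [hφ'] at hT'
    exact hT'.unique hT
  · obtain ⟨γ, hγ⟩ := exists_artin_units (isUnit_g M) (fun _ _ => g_comm M) (fun _ _ => g_braid M)
    refine ⟨γ, hγ, ?_⟩
    obtain ⟨ψ, hψ⟩ := exists_BMWModI₂_hom_of_quad M (fun i => extend M (sigma M T i))
      (fun i => extend M (quadSigma M T i))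
      (fun i j hn => by rw [← extend_mul, ← extend_mul, hcomm i j hn])
      (fun i j hn => by simp only [← extend_mul, hbraid i j hn])
      (fun i => by
        rw [quadSigma, extend_sub, extend_add, extend_mul, extend_smul, extend_one]
        rfl)
      (fun i => by
        rw [← extend_mul, hc.sigma_mul_quadSigma hφ, extend_smul]
        rfl)
      (fun i j hn => by
        rw [← extend_mul, ← extend_mul, hc.quadSigma_sigma_quadSigma hφ hn, extend_smul]
        rfl)
      (fun i j hij hn => by
        rw [← extend_mul, hc.quadSigma_mul_quadSigma hφ hij hn, extend_zero])
    have hgen (i : I) : ψ ((γ (s M i) : BMW M) : BMWModI₂ M) = extendHom.comp ρ (s M i) := by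
      rw [hγ, hψ]
      exact congrArg (extend M) (hρ₀ i).symm
    have hψρ := BMWModI₂_hom_eq (A := Module.End K (V M)) M ψ γ (extendHom.comp ρ) hgen
    exact ⟨ψ, fun a => hψρ a⟩
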